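/- Let $n\ge 5$, let $(a_{ij})_{1\le i,j\le n}$ be real numbers with $a_{ij}=a_{ji}$, and let $Y=\sum_{i=1}^n a_{i\pi(i)}$, where $\pi$ is a random permutation of $\{1,\dots,n\}$. Put $$a_{io}=\frac1{n-2}\sum_{j\ne i}a_{ij},\qquad a_{oo}=\frac1{(n-1)(n-2)}\sum_{i\ne j}a_{ij},\qquad \mu=(n-2)a_{oo},\qquad d_{ij}=a_{ij}-a_{io}-a_{jo}+a_{oo},$$ $$\sigma_\iota^2=\frac{2(n-2)}{(n-1)(n-3)}\sum_{i\ne j}d_{ij}^2,\qquad \sigma_f^2=\frac1{n-1}\sum_{i\ne j}d_{ij}^2,\qquad a_o=\max_{i\ne j}|d_{ij}|.$$ For a real random variable $W$ and $v,c>0$, say that $W$ satisfies the bounds $B(v,c)$ if for all $t\ge0$ both $\mathbb P(W\ge t)$ and $\mathbb P(W\le -t)$ are at most $$\exp\Big(-\frac{t^2}{2(v+ct)}\Big)\quad\text{and at most}\quad \exp\Big(-\frac{t^2}{10v/3+ct}\Big),$$ and for all $t>e$ both are at most $$\exp\Big(-\frac tc\Big(\log t-\log\log t-\frac vc\Big)\Big)\le\exp\Big(-\frac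 t{2c}\Big(\log t-\frac{2v}c\Big)\Big).$$ (1) If $\pi$ is uniformly distributed over the fixed point free involutions of $\{1,\dots,n\}$, then $\mathbb E[Y]=\mu$ and $\mathrm{Var}(Y)=\sigma_\iota^2$, and, provided $\sigma_\iota^2>0$, the variable $Y-\mu$ satisfies $B(\sigma_\iota^2,24a_o)$. (2) If the law of $\pi$ is constant on cycle type (permutations with the same number of $q$-cycles for every $q$ are equally likely) and $\pi$ has almost surely no fixed points and no $2$-cycles, then $\mathbb E[Y]=\mu$ and $\mathrm{Var}(Y)=\sigma_f^2$, and, provided $\sigma_f^2>0$, the variable $Y-\mu$ satisfies $B(\sigma_f^2,40a_o)$. Moreover, the tail bounds in (1) and (2) also hold if $d_{ij}$ is replaced throughout the definitions of $\sigma_\iota^2$, $\sigma_f^2$ and $a_o$ by $a_{ij}-2a_{io}+a_{oo}$, again provided that the resulting $\sigma_\iota^2$, respectively $\sigma_f^2$, is positive. -/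

import Mathlib

open MeasureTheory ProbabilityTheory

noncomputable section

namespace CombClt

/-- Hoeffding's statistic `Y = ∑ i, a i (τ i)` of the array `a` at the permutation `τ`. -/
def hoeffdingStat {n : ℕ} (a : Fin n → Fin n → ℝ) (τ : Equiv.Perm (Fin n)) : ℝ :=
  ∑ i, a i (τ i)

/-- `a_{io} = (n - 2)⁻¹ ∑_{j ≠ i} a_{ij}`. -/
def rowMean {n : ℕ} (a : Fin n → Fin n → ℝ) (i : Fin n) : ℝ :=
  (1 / ((n : ℝ) - 2)) * ∑ j with j ≠ i, a i j

/-- `a_{oo} = ((n - 1)(n - 2))⁻¹ ∑_{i ≠ j} a_{ij}`. -/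
def grandMean {n : ℕ} (a : Fin n → Fin n → ℝ) : ℝ :=
  (1 / (((n : ℝ) - 1) * ((n : ℝ) - 2))) * ∑ p : Fin n × Fin n with p.1 ≠ p.2, a p.1 p.2

/-- The centring constant `μ = (n - 2) a_{oo}`. -/
def meanConst {n : ℕ} (a : Fin n → Fin n → ℝ) : ℝ :=
  ((n : ℝ) - 2) * grandMean a

/-- The symmetrically centred array `a_{ij} - a_{io} - a_{jo} + a_{oo}`. -/
def symmCentred {n : ℕ} (a : Fin n → Fin n → ℝ) (i j : Fin n) : ℝ :=
  a i j - rowMean a i - rowMean a j + grandMean a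

/-- The array `a_{ij} - 2 a_{io} + a_{oo}`, centred by rows only. -/
def rowCentred {n : ℕ} (a : Fin n → Fin n → ℝ) (i j : Fin n) : ℝ :=
  a i j - 2 * rowMean a i + grandMean a

/-- `∑_{i ≠ j} d_{ij}²`. -/
def offDiagSq {n : ℕ} (d : Fin n → Fin n → ℝ) : ℝ :=
  ∑ p : Fin n × Fin n with p.1 ≠ p.2, d p.1 p.2 ^ 2

/-- `max_{i ≠ j} |d_{ij}|` (a supremum of a finite family, which is non-empty for `n ≥ 2`). -/
def offDiagMax {n : ℕ} (d : Fin n → Fin n → ℝ) : ℝ :=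
  ⨆ p : {p : Fin n × Fin n // p.1 ≠ p.2}, |d p.1.1 p.1.2|

/-- `2 (n - 2) / ((n - 1)(n - 3)) · ∑_{i ≠ j} d_{ij}²`. -/
def varInvolution {n : ℕ} (d : Fin n → Fin n → ℝ) : ℝ :=
  2 * ((n : ℝ) - 2) / (((n : ℝ) - 1) * ((n : ℝ) - 3)) * offDiagSq d

/-- `1 / (n - 1) · ∑_{i ≠ j} d_{ij}²`. -/
def varLongCycles {n : ℕ} (d : Fin n → Fin n → ℝ) : ℝ :=
  1 / ((n : ℝ) - 1) * offDiagSq d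

/-- The number `f_q(τ)` of `q`-cycles of `τ`; the fixed points are its `1`-cycles. -/
def cycleCount {n : ℕ} (q : ℕ) (τ : Equiv.Perm (Fin n)) : ℕ :=
  τ.partition.parts.count q

/-- The fixed point free involutions of `Fin n`. -/
def fpfInvolutions (n : ℕ) : Finset (Equiv.Perm (Fin n)) :=
  {τ | (∀ i, τ (τ i) = i) ∧ ∀ i, τ i ≠ i}

/-- The random permutation `π` is uniformly distributed over the fixed point free involutions. -/
def IsUniformFpfInvolution {n : ℕ} {Ω : Type*} [MeasurableSpace Ω] (P : Measure Ω)
    (π : Ω → Equiv.Perm (Fin n)) : Prop :=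
  ∀ τ, P.real {ω | π ω = τ} =
    if τ ∈ fpfInvolutions n then 1 / ((fpfInvolutions n).card : ℝ) else 0

/-- The law of `π` is constant on cycle type: permutations with the same numbers of `q`-cycles
for all `q` are equally likely. -/
def IsConstantOnCycleType {n : ℕ} {Ω : Type*} [MeasurableSpace Ω] (P : Measure Ω)
    (π : Ω → Equiv.Perm (Fin n)) : Prop :=
  ∀ τ τ' : Equiv.Perm (Fin n), (∀ q, cycleCount q τ = cycleCount q τ') →
    P.real {ω | π ω = τ} = P.real {ω | π ω = τ'}

/-- The right and left tail bounds for a centred variable `W`, with variance parameter `v`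
and coupling constant `c`. -/
structure TailBounds {Ω : Type*} [MeasurableSpace Ω] (P : Measure Ω) (W : Ω → ℝ) (v c : ℝ) :
    Prop where
  right_one : ∀ t : ℝ, 0 ≤ t →
    P.real {ω | t ≤ W ω} ≤ Real.exp (-(t ^ 2 / (2 * (v + c * t))))
  left_one : ∀ t : ℝ, 0 ≤ t →
    P.real {ω | W ω ≤ -t} ≤ Real.exp (-(t ^ 2 / (2 * (v + c * t))))
  right_two : ∀ t : ℝ, 0 ≤ t →
    P.real {ω | t ≤ W ω} ≤ Real.exp (-(t ^ 2 / (10 * v / 3 + c * t)))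
  left_two : ∀ t : ℝ, 0 ≤ t →
    P.real {ω | W ω ≤ -t} ≤ Real.exp (-(t ^ 2 / (10 * v / 3 + c * t)))
  right_log : ∀ t : ℝ, Real.exp 1 < t →
    P.real {ω | t ≤ W ω} ≤
      Real.exp (-(t / c) * (Real.log t - Real.log (Real.log t) - v / c))
  left_log : ∀ t : ℝ, Real.exp 1 < t →
    P.real {ω | W ω ≤ -t} ≤
      Real.exp (-(t / c) * (Real.log t - Real.log (Real.log t) - v / c))
  log_le : ∀ t : ℝ, Real.exp 1 < t →
    Real.exp (-(t / c) * (Real.log t - Real.log (Real.log t) - v / c)) ≤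
      Real.exp (-(t / (2 * c)) * (Real.log t - 2 * v / c))

end CombClt

end

/-!
The law of `π` is conjugation invariant, so `π` may be replaced by `σ τ σ⁻¹` with `τ` distributed
as `π` and `σ` an independent uniform permutation. The whole argument is carried out for a fixed
`τ` and a uniform `σ`. After centring, `Y - μ` is `W(σ) = ∑ x, d (σ x) (σ (τ x))` for a symmetric
array `d` with zero diagonal and zero row sums (`relabelStat`, `centredArray`).

Exchangeable pair. Compare `W(σ)` with `W' = W(σ * swap i j)`. Vanishing of the row sums gives
`∑ i, ∑ j, (W' - W) = -4 (n - 1) W`, hence the Stein identity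
`8 (n - 1) ∑ σ, W f(W) = ∑ i, ∑ j, ∑ σ, (W' - W) (f(W') - f(W))` (`stein_identity`). For
`f(w) = exp (s w)` the summand is at most `s (W' - W)² max (exp (s W), exp (s W'))`.

Decoupling. The increment `W' - W` depends only on the values of `σ` on the set `A` of `i`, `j` and
their neighbours in the cycles of `τ`. A uniform `σ` can be changed, only on `A` and on at most `#A`
further points, into a permutation that agrees on `A` with a prescribed `ρ` and is otherwise uniform
(`steer`, `sum_sum_steer`). This alters at most 12 summands of `W` if `τ` is an involution and at
most 20 in general, each by at most `2 a_o`; these are the sources of the constants 24 and 40. The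
result is the zero bias inequality `E[W exp (s W)] ≤ s v exp (c s) E[exp (s W)]` with `v = E[W²]`
(`exp_bias_bound`).

Variance. By symmetry and vanishing row sums, the correlation of two entries of the relabelled
array takes one of three values according to whether the index pairs coincide, share a point or are
disjoint, and all three are explicit multiples of `∑ d²` (`entryCorr_self`, `entryCorr_adjacent`,
`entryCorr_disjoint`).

Tails. The inequality says `M' ≤ v s exp (c s) M` for the moment generating function `M`. Replacing
`s exp (c s)` by one of three majorants with explicit primitives, integrating, and applying
Chernoff's bound gives the three tail bounds (`ExpBiasBound.rightTailBounds`).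
The inequality is monotone in `v` and `c`, and symmetrising an array increases neither `∑ d²` nor
`max |d|`, which gives the version with the row centred array.
-/

namespace CombClt

open Equiv

/-! ### The relabelled statistic and Stein's identity -/

section

variable {ι : Type*} [Fintype ι]

/-- A symmetric array with zero diagonal and zero row sums. -/
structure IsCentred (d : ι → ι → ℝ) : Prop where
  symm : ∀ i j, d i j = d j i
  diag : ∀ i, d i i = 0
  row : ∀ i, ∑ j, d i j = 0

/-- The value at `σ τ σ⁻¹` of the statistic `∑ i, d i (π i)`, as a function of the relabelling
`σ`: see `sum_apply_conj`. -/
def relabelStat (d : ι → ι → ℝ) (τ σ : Perm ι) : ℝ :=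
  ∑ x, d (σ x) (σ (τ x))

theorem sum_apply_conj (d : ι → ι → ℝ) (τ σ : Perm ι) :
    ∑ i, d i ((σ * τ * σ⁻¹) i) = relabelStat d τ σ := by
  unfold relabelStat
  rw [← Equiv.sum_comp σ]
  simp

theorem IsCentred.relabel {d : ι → ι → ℝ} (hd : IsCentred d) (σ : Perm ι) :
    IsCentred fun i j => d (σ i) (σ j) where
  symm _ _ := hd.symm _ _
  diag _ := hd.diag _
  row i := (Equiv.sum_comp σ (d (σ i))).trans (hd.row _)

theorem IsCentred.neg {d : ι → ι → ℝ} (hd : IsCentred d) : IsCentred fun i j => -d i j where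
  symm i j := by rw [hd.symm]
  diag i := by rw [hd.diag, neg_zero]
  row i := by rw [Finset.sum_neg_distrib, hd.row, neg_zero]

theorem relabelStat_neg (d : ι → ι → ℝ) (τ σ : Perm ι) :
    relabelStat (fun i j => -d i j) τ σ = -relabelStat d τ σ := by
  simp [relabelStat]

theorem abs_relabelStat_sub_le {d : ι → ι → ℝ} {a : ℝ} (hda : ∀ i j, |d i j| ≤ a)
    (τ : Perm ι) {σ σ' : Perm ι} {N : Finset ι}
    (hN : ∀ x ∉ N, σ' x = σ x ∧ σ' (τ x) = σ (τ x)) :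
    |relabelStat d τ σ' - relabelStat d τ σ| ≤ 2 * a * N.card := by
  rw [relabelStat, relabelStat, ← Finset.sum_sub_distrib,
    ← Finset.sum_subset (Finset.subset_univ N)
      fun x _ hx => by rw [(hN x hx).1, (hN x hx).2, sub_self]]
  calc |∑ x ∈ N, (d (σ' x) (σ' (τ x)) - d (σ x) (σ (τ x)))|
      ≤ ∑ x ∈ N, |d (σ' x) (σ' (τ x)) - d (σ x) (σ (τ x))| := Finset.abs_sum_le_sum_abs _ _
    _ ≤ ∑ x ∈ N, 2 * a := Finset.sum_le_sum fun x _ =>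
        (abs_sub _ _).trans (by linarith [hda (σ' x) (σ' (τ x)), hda (σ x) (σ (τ x))])
    _ = 2 * a * N.card := by rw [Finset.sum_const, nsmul_eq_mul]; ring

variable [DecidableEq ι]

theorem IsCentred.sum_swap_sub {d : ι → ι → ℝ} (hd : IsCentred d) {x y : ι} (hxy : x ≠ y) :
    ∑ i, ∑ j, (d (swap i j x) (swap i j y) - d x y) = -4 * ((Fintype.card ι : ℝ) - 1) * d x y := by
  -- The swap contributes when it moves `x` or `y`; the last two summands correct for the swap of
  -- `x` with `y`.
  have key : ∀ i j, d (swap i j x) (swap i j y) - d x y =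
      (if x = i then d j y - d x y else 0) + (if x = j then d i y - d x y else 0) +
      (if y = i then d x j - d x y else 0) + (if y = j then d x i - d x y else 0) +
      (if x = i then (if y = j then 2 * d x y else 0) else 0) +
      (if x = j then (if y = i then 2 * d x y else 0) else 0) := by
    intro i j
    by_cases h1 : x = i <;> by_cases h2 : x = j <;> by_cases h3 : y = i <;> by_cases h4 : y = j <;>
      first
      | (exfalso; apply hxy; simp_all; done)
      | (have e1 := hd.diag x; have e2 := hd.diag y; have e3 := hd.symm x y
         simp_all [swap_apply_def]
         try linarith)
  have r1 : ∀ y, ∑ j, d j y = 0 := fun y => by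
    rw [← hd.row y]; exact Finset.sum_congr rfl fun j _ => hd.symm _ _
  have sum_if : ∀ (z : ι) (f : ι → ℝ), ∑ i, (if z = i then f i else 0) = f z := fun z f => by
    simp
  have sum_if' : ∀ (z : ι) (f : ι → ι → ℝ),
      ∑ i, ∑ j, (if z = i then f i j else 0) = ∑ j, f z j := fun z f => by
    rw [Finset.sum_comm]; simp
  simp only [key, Finset.sum_add_distrib, sum_if, sum_if', Finset.sum_sub_distrib, r1, hd.row,
    Finset.sum_const, Finset.card_univ, nsmul_eq_mul]
  ring

theorem sum_relabelStat_swap_sub {d : ι → ι → ℝ} (hd : IsCentred d) {τ : Perm ι}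
    (hτ : ∀ x, τ x ≠ x) (σ : Perm ι) :
    ∑ i, ∑ j, (relabelStat d τ (σ * swap i j) - relabelStat d τ σ)
      = -4 * ((Fintype.card ι : ℝ) - 1) * relabelStat d τ σ := by
  simp only [relabelStat, ← Finset.sum_sub_distrib, Perm.mul_apply]
  have : ∀ i : ι, ∑ j, ∑ x, (d (σ (swap i j x)) (σ (swap i j (τ x))) - d (σ x) (σ (τ x)))
      = ∑ x, ∑ j, (d (σ (swap i j x)) (σ (swap i j (τ x))) - d (σ x) (σ (τ x))) :=
    fun i => Finset.sum_comm
  simp only [this]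
  rw [Finset.sum_comm, Finset.mul_sum]
  exact Finset.sum_congr rfl fun x _ => (hd.relabel σ).sum_swap_sub (hτ x).symm

/-- Stein's identity for the exchangeable pair `σ`, `σ * swap i j`, with `i`, `j` uniform. -/
theorem stein_identity {d : ι → ι → ℝ} (hd : IsCentred d) {τ : Perm ι}
    (hτ : ∀ x, τ x ≠ x) (f : ℝ → ℝ) :
    ∑ i, ∑ j, ∑ σ, (relabelStat d τ (σ * swap i j) - relabelStat d τ σ) *
        (f (relabelStat d τ (σ * swap i j)) - f (relabelStat d τ σ))
      = 8 * ((Fintype.card ι : ℝ) - 1) * ∑ σ, relabelStat d τ σ * f (relabelStat d τ σ) := by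
  set W := relabelStat d τ with hW
  have step : ∀ i j, ∑ σ, (W (σ * swap i j) - W σ) * (f (W (σ * swap i j)) - f (W σ))
      = -2 * ∑ σ, (W (σ * swap i j) - W σ) * f (W σ) := by
    intro i j
    -- The substitution `σ ↦ σ * swap i j` exchanges the two members of the pair.
    have h := Equiv.sum_comp (Equiv.mulRight (swap i j))
      fun σ => (W (σ * swap i j) - W σ) * f (W σ)
    simp only [Equiv.coe_mulRight, mul_assoc, swap_mul_self, mul_one] at h
    have h' : ∑ σ, (W (σ * swap i j) - W σ) * f (W (σ * swap i j))
        = -∑ σ, (W (σ * swap i j) - W σ) * f (W σ) := by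
      rw [← h, ← Finset.sum_neg_distrib]
      exact Finset.sum_congr rfl fun σ _ => by ring
    simp only [mul_sub, Finset.sum_sub_distrib, h']
    ring
  simp only [step, ← Finset.mul_sum]
  have h1 : ∀ i, ∑ j, ∑ σ, (W (σ * swap i j) - W σ) * f (W σ)
      = ∑ σ, ∑ j, (W (σ * swap i j) - W σ) * f (W σ) := fun i => Finset.sum_comm
  simp only [h1]
  rw [Finset.sum_comm]
  simp only [← Finset.sum_mul, hW, sum_relabelStat_swap_sub hd hτ]
  rw [Finset.mul_sum, Finset.mul_sum]
  exact Finset.sum_congr rfl fun σ _ => by ring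

end

/-! ### Decoupling by steering a permutation -/

section

variable {ι : Type*} [DecidableEq ι]

/-- Swaps values of `σ`, one point of the list at a time, until it agrees with `ρ` on the list. -/
def steer (ρ : Perm ι) : List ι → Perm ι → Perm ι
  | [], σ => σ
  | x :: l, σ => steer ρ l (σ * swap x (σ⁻¹ (ρ x)))

/-- Steering commutes with the right action of the permutations fixing the list pointwise. -/
theorem steer_mul (ρ : Perm ι) {l : List ι} {h : Perm ι} (hh : ∀ x ∈ l, h x = x) (σ : Perm ι) :
    steer ρ l (σ * h) = steer ρ l σ * h := by
  induction l generalizing σ with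
  | nil => rfl
  | cons x l ih =>
    have hx : h⁻¹ x = x := by
      rw [Perm.inv_eq_iff_eq]; exact (hh x (by simp)).symm
    have hx' : h x = x := hh x (by simp)
    have : σ * h * swap x ((σ * h)⁻¹ (ρ x)) = σ * swap x (σ⁻¹ (ρ x)) * h := by
      have h1 : swap x (σ⁻¹ (ρ x)) = h * swap x (h⁻¹ (σ⁻¹ (ρ x))) * h⁻¹ := by
        rw [← swap_apply_apply, hx']; simp
      rw [h1, mul_inv_rev, Perm.mul_apply]
      group
    simp only [steer]
    rw [this, ih fun y hy => hh y (List.mem_cons_of_mem _ hy)]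

theorem steer_apply_of_eq {ρ σ : Perm ι} (l : List ι) {y : ι} (h : σ y = ρ y) :
    steer ρ l σ y = ρ y := by
  induction l generalizing σ with
  | nil => exact h
  | cons x l ih =>
    refine ih ?_
    rw [Perm.mul_apply, swap_apply_def]
    split_ifs with h1 h2
    · simp [h1]
    · have h3 : σ y = ρ x := by rw [h2]; simp
      rw [ρ.injective (h3.symm.trans h), h]
    · exact h

theorem steer_apply_of_mem {ρ : Perm ι} {l : List ι} {y : ι} (hy : y ∈ l) (σ : Perm ι) :
    steer ρ l σ y = ρ y := by
  induction l generalizing σ with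
  | nil => simp at hy
  | cons x l ih =>
    rcases List.mem_cons.1 hy with rfl | hy
    · exact steer_apply_of_eq l (by simp)
    · exact ih hy _

theorem steer_apply_of_notMem {ρ σ : Perm ι} {l : List ι} {y : ι} (hy : y ∉ l)
    (hσ : ∀ x ∈ l, σ y ≠ ρ x) : steer ρ l σ y = σ y := by
  induction l generalizing σ with
  | nil => rfl
  | cons x l ih =>
    have h1 : (σ * swap x (σ⁻¹ (ρ x))) y = σ y := by
      rw [Perm.mul_apply, swap_apply_of_ne_of_ne]
      · rintro rfl; simp at hy
      · rintro rfl; exact hσ x (by simp) (by simp)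
    rw [steer, ih (fun h => hy (by simp [h])) fun z hz => ?_, h1]
    rw [h1]; exact hσ z (by simp [hz])

/-- Every two points lie, together with their images and preimages under `τ`, in a set `A` such
that relabelling `A` and `#A` further points affects at most `m` summands of `relabelStat`. -/
def HasSmallNeighbourhoods (τ : Perm ι) (m : ℕ) : Prop :=
  ∀ i j, ∃ A : Finset ι, i ∈ A ∧ j ∈ A ∧ τ i ∈ A ∧ τ j ∈ A ∧ τ⁻¹ i ∈ A ∧ τ⁻¹ j ∈ A ∧
    (A ∪ A.image ⇑τ⁻¹).card + 2 * A.card ≤ m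

theorem hasSmallNeighbourhoods_of_involution {τ : Perm ι} (hinv : ∀ x, τ (τ x) = x) :
    HasSmallNeighbourhoods τ 12 := by
  intro i j
  have hi : ∀ x, τ⁻¹ x = τ x := fun x => by rw [Perm.inv_eq_iff_eq, hinv]
  refine ⟨{i, j, τ i, τ j}, by simp, by simp, by simp, by simp, by simp [hi], by simp [hi], ?_⟩
  have h1 : ({i, j, τ i, τ j} ∪ ({i, j, τ i, τ j} : Finset ι).image ⇑τ⁻¹)
      ⊆ ({i, j, τ i, τ j} : Finset ι) := by
    intro x
    simp only [Finset.mem_union, Finset.mem_image, Finset.mem_insert, Finset.mem_singleton, hi]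
    rintro (h | ⟨y, rfl | rfl | rfl | rfl, rfl⟩) <;> simp [*]
  have h2 : ({i, j, τ i, τ j} : Finset ι).card ≤ 4 := Finset.card_le_four
  have h3 := Finset.card_le_card h1
  omega

theorem hasSmallNeighbourhoods (τ : Perm ι) : HasSmallNeighbourhoods τ 20 := by
  intro i j
  refine ⟨{i, j, τ i, τ j, τ⁻¹ i, τ⁻¹ j}, by simp, by simp, by simp, by simp, by simp, by simp, ?_⟩
  have h1 : ({i, j, τ i, τ j, τ⁻¹ i, τ⁻¹ j}
        ∪ ({i, j, τ i, τ j, τ⁻¹ i, τ⁻¹ j} : Finset ι).image ⇑τ⁻¹)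
      ⊆ ({i, j, τ i, τ j, τ⁻¹ i, τ⁻¹ j} : Finset ι) ∪ {τ⁻¹ (τ⁻¹ i), τ⁻¹ (τ⁻¹ j)} := by
    intro x
    simp only [Finset.mem_union, Finset.mem_image, Finset.mem_insert, Finset.mem_singleton]
    rintro (h | ⟨y, rfl | rfl | rfl | rfl | rfl | rfl, rfl⟩)
    · exact Or.inl h
    all_goals simp
  have h2 : ({i, j, τ i, τ j, τ⁻¹ i, τ⁻¹ j} : Finset ι).card ≤ 6 := Finset.card_le_six
  have h3 : ({τ⁻¹ (τ⁻¹ i), τ⁻¹ (τ⁻¹ j)} : Finset ι).card ≤ 2 := Finset.card_le_two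
  have h4 := (Finset.card_le_card h1).trans (Finset.card_union_le _ _)
  omega

variable [Fintype ι]

/-- If `σ` and `ρ` are independent uniform permutations, then, given the restriction of `ρ` to
`l`, the steered permutation has the conditional law of `ρ`. -/
theorem sum_sum_steer (l : List ι) (D F : Perm ι → ℝ)
    (hD : ∀ ρ h : Perm ι, (∀ x ∈ l, h x = x) → D (ρ * h) = D ρ) :
    ∑ σ, ∑ ρ, D ρ * F (steer ρ l σ) = Fintype.card (Perm ι) * ∑ ρ, D ρ * F ρ := by
  set H : Finset (Perm ι) := {h | ∀ x ∈ l, h x = x} with hH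
  have memH : ∀ h, h ∈ H ↔ ∀ x ∈ l, h x = x := fun h => by simp [hH]
  have one_mem : (1 : Perm ι) ∈ H := (memH 1).2 fun x _ => rfl
  have hHpos : (H.card : ℝ) ≠ 0 := by
    exact_mod_cast (Finset.card_pos.2 ⟨1, one_mem⟩).ne'
  -- Both sides are averaged over the stabiliser, on whose cosets `steer ρ l σ` and `ρ` agree.
  have coset : ∀ σ ρ, ∑ h ∈ H, F (steer ρ l σ * h) = ∑ h ∈ H, F (ρ * h) := by
    intro σ ρ
    refine Finset.sum_equiv (Equiv.mulLeft (ρ⁻¹ * steer ρ l σ)) (fun h => ?_) fun h _ => ?_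
    · have hfix : ∀ x ∈ l, steer ρ l σ x = ρ x := fun x hx => steer_apply_of_mem hx σ
      rw [memH, memH]
      constructor
      · intro hh x hx
        simp [hh x hx, hfix x hx]
      · intro hh x hx
        have h1 := hh x hx
        simp only [coe_mulLeft, Perm.mul_apply, Perm.inv_eq_iff_eq] at h1
        rw [← hfix x hx] at h1
        exact (steer ρ l σ).injective h1
    · simp
  have h1 : ∀ h ∈ H, ∑ σ, ∑ ρ, D ρ * F (steer ρ l σ * h)
      = ∑ σ, ∑ ρ, D ρ * F (steer ρ l σ) := by
    intro h hh
    rw [← Equiv.sum_comp (Equiv.mulRight h) fun σ => ∑ ρ, D ρ * F (steer ρ l σ)]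
    simp only [coe_mulRight, steer_mul _ ((memH h).1 hh)]
  have h2 : ∀ h ∈ H, ∑ ρ, D ρ * F (ρ * h) = ∑ ρ, D ρ * F ρ := by
    intro h hh
    rw [← Equiv.sum_comp (Equiv.mulRight h) fun ρ => D ρ * F ρ]
    simp only [coe_mulRight, hD _ h ((memH h).1 hh)]
  apply mul_left_cancel₀ hHpos
  calc (H.card : ℝ) * ∑ σ, ∑ ρ, D ρ * F (steer ρ l σ)
      = ∑ h ∈ H, ∑ σ, ∑ ρ, D ρ * F (steer ρ l σ * h) := by
        rw [Finset.sum_congr rfl h1, Finset.sum_const, nsmul_eq_mul]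
    _ = ∑ σ, ∑ ρ, D ρ * ∑ h ∈ H, F (steer ρ l σ * h) := by
        rw [Finset.sum_comm]
        refine Finset.sum_congr rfl fun σ _ => ?_
        rw [Finset.sum_comm]
        simp only [Finset.mul_sum]
    _ = ∑ _σ : Perm ι, ∑ h ∈ H, ∑ ρ, D ρ * F (ρ * h) := by
        refine Finset.sum_congr rfl fun σ _ => ?_
        simp only [coset, Finset.mul_sum]
        rw [Finset.sum_comm]
    _ = (H.card : ℝ) * (Fintype.card (Perm ι) * ∑ ρ, D ρ * F ρ) := by
        rw [Finset.sum_congr rfl fun σ _ => Finset.sum_congr rfl h2]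
        simp only [Finset.sum_const, Finset.card_univ, nsmul_eq_mul]
        ring

/-- Both members of the exchangeable pair at the steered permutation are close to the statistic at
`σ`, since the swap of `i` and `j` only acts on points of `A`. -/
theorem abs_relabelStat_steer_sub_le {d : ι → ι → ℝ} {a : ℝ} (hda : ∀ i j, |d i j| ≤ a)
    {τ : Perm ι} {m : ℕ} {A : Finset ι} (hA : (A ∪ A.image ⇑τ⁻¹).card + 2 * A.card ≤ m)
    {i j : ι} (hi : i ∈ A) (hj : j ∈ A) (ha : 0 ≤ a) (ρ σ : Perm ι) :
    |relabelStat d τ (steer ρ A.toList σ) - relabelStat d τ σ| ≤ 2 * a * m ∧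
    |relabelStat d τ (steer ρ A.toList σ * swap i j) - relabelStat d τ σ| ≤ 2 * a * m := by
  set B : Finset ι := A.image fun x => σ⁻¹ (ρ x) with hB
  set N : Finset ι := (A ∪ A.image ⇑τ⁻¹) ∪ (B ∪ B.image ⇑τ⁻¹) with hN
  have hcard : N.card ≤ m := by
    have h1 : N.card ≤ (A ∪ A.image ⇑τ⁻¹).card + (B.card + (B.image ⇑τ⁻¹).card) :=
      (Finset.card_union_le _ _).trans (by gcongr; exact Finset.card_union_le _ _)
    have h2 : B.card ≤ A.card := Finset.card_image_le
    have h3 : (B.image ⇑τ⁻¹).card ≤ B.card := Finset.card_image_le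
    omega
  have hsteer : ∀ y, y ∉ A → y ∉ B → steer ρ A.toList σ y = σ y := fun y h1 h2 =>
    steer_apply_of_notMem (by simpa using h1) fun x hx h => h2 <| by
      rw [hB, Finset.mem_image]
      exact ⟨x, by simpa using hx, by rw [← h]; simp⟩
  have hswap : ∀ y, y ∉ A → y ∉ B → (steer ρ A.toList σ * swap i j) y = σ y := fun y h1 h2 => by
    rw [Perm.mul_apply, swap_apply_of_ne_of_ne (by rintro rfl; exact h1 hi)
      (by rintro rfl; exact h1 hj), hsteer y h1 h2]
  have hout : ∀ x ∉ N, (x ∉ A ∧ x ∉ B) ∧ τ x ∉ A ∧ τ x ∉ B := by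
    intro x hx
    simp only [hN, Finset.mem_union, Finset.mem_image, not_or, not_exists, not_and] at hx
    exact ⟨⟨hx.1.1, hx.2.1⟩, fun h => hx.1.2 _ h (by simp), fun h => hx.2.2 _ h (by simp)⟩
  have hle : 2 * a * (N.card : ℝ) ≤ 2 * a * m := by gcongr
  constructor
  · refine (abs_relabelStat_sub_le hda τ fun x hx => ?_).trans hle
    exact ⟨hsteer x (hout x hx).1.1 (hout x hx).1.2, hsteer _ (hout x hx).2.1 (hout x hx).2.2⟩
  · refine (abs_relabelStat_sub_le hda τ fun x hx => ?_).trans hle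
    exact ⟨hswap x (hout x hx).1.1 (hout x hx).1.2, hswap _ (hout x hx).2.1 (hout x hx).2.2⟩

/-- The effect of swapping `i` and `j` depends only on the labels of `i`, `j` and their images and
preimages under `τ`. -/
theorem relabelStat_swap_sub_mul (d : ι → ι → ℝ) {τ : Perm ι} {A : Finset ι} {i j : ι}
    (hi : i ∈ A) (hj : j ∈ A) (hi' : τ i ∈ A) (hj' : τ j ∈ A) (hi'' : τ⁻¹ i ∈ A)
    (hj'' : τ⁻¹ j ∈ A) (ρ : Perm ι) {h : Perm ι} (hh : ∀ x ∈ A, h x = x) :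
    relabelStat d τ (ρ * h * swap i j) - relabelStat d τ (ρ * h)
      = relabelStat d τ (ρ * swap i j) - relabelStat d τ ρ := by
  simp only [relabelStat, ← Finset.sum_sub_distrib]
  refine Finset.sum_congr rfl fun x _ => ?_
  have hsw : ∀ y ∈ A, h (swap i j y) = swap i j y := fun y hy => hh _ <| by
    rw [swap_apply_def]; split_ifs <;> assumption
  by_cases hx : x ∈ A ∧ τ x ∈ A
  · simp only [Perm.mul_apply, hsw x hx.1, hsw _ hx.2, hh x hx.1, hh _ hx.2]
  · have h1 : swap i j x = x := swap_apply_of_ne_of_ne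
      (by rintro rfl; exact hx ⟨hi, hi'⟩) (by rintro rfl; exact hx ⟨hj, hj'⟩)
    have h2 : swap i j (τ x) = τ x := swap_apply_of_ne_of_ne
      (by rintro rfl; exact hx ⟨by simpa using hi'', hi⟩)
      (by rintro rfl; exact hx ⟨by simpa using hj'', hj⟩)
    simp only [Perm.mul_apply, h1, h2, sub_self]

theorem sub_mul_exp_sub_le {s : ℝ} (hs : 0 ≤ s) (x y : ℝ) :
    (y - x) * (Real.exp (s * y) - Real.exp (s * x))
      ≤ s * ((y - x) ^ 2 * max (Real.exp (s * y)) (Real.exp (s * x))) := by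
  wlog h : x ≤ y generalizing x y
  · have := this y x (le_of_not_ge h)
    rw [max_comm] at this
    linarith
  have h1 : Real.exp (s * x) = Real.exp (s * y) * Real.exp (s * x - s * y) := by
    rw [← Real.exp_add]; ring_nf
  have h2 := Real.add_one_le_exp (s * x - s * y)
  have h3 : Real.exp (s * y) - Real.exp (s * x) ≤ s * (y - x) * Real.exp (s * y) := by
    rw [h1]; nlinarith [Real.exp_pos (s * y)]
  calc (y - x) * (Real.exp (s * y) - Real.exp (s * x))
      ≤ (y - x) * (s * (y - x) * Real.exp (s * y)) :=
        mul_le_mul_of_nonneg_left h3 (sub_nonneg.2 h)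
    _ = s * ((y - x) ^ 2 * Real.exp (s * y)) := by ring
    _ ≤ _ := by gcongr; exact le_max_left _ _

/-- The zero bias inequality `E[W exp (s W)] ≤ s exp (c s) E[W²] E[exp (s W)]` for a fixed `τ` and
a uniform relabelling, with `c = 2 a m`. -/
theorem exp_bias_bound {d : ι → ι → ℝ} (hd : IsCentred d) {a : ℝ} (hda : ∀ i j, |d i j| ≤ a)
    {τ : Perm ι} (hτ : ∀ x, τ x ≠ x) {m : ℕ} (hm : HasSmallNeighbourhoods τ m)
    (hcard : 1 < Fintype.card ι) {s : ℝ} (hs : 0 ≤ s) :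
    Fintype.card (Perm ι) * ∑ σ, relabelStat d τ σ * Real.exp (s * relabelStat d τ σ) ≤
      s * Real.exp (2 * a * m * s) * (∑ σ, relabelStat d τ σ ^ 2) *
        ∑ σ, Real.exp (s * relabelStat d τ σ) := by
  set W := relabelStat d τ with hW
  set E : ℝ := Real.exp (2 * a * m * s) with hE
  have : Nonempty ι := Fintype.card_pos_iff.1 (by omega)
  have ha : 0 ≤ a := (abs_nonneg _).trans (hda (Classical.arbitrary ι) (Classical.arbitrary ι))
  have key : ∀ i j, Fintype.card (Perm ι) * ∑ ρ, (W (ρ * swap i j) - W ρ) *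
        (Real.exp (s * W (ρ * swap i j)) - Real.exp (s * W ρ)) ≤
      s * E * (∑ ρ, (W (ρ * swap i j) - W ρ) ^ 2) * ∑ σ, Real.exp (s * W σ) := by
    intro i j
    obtain ⟨A, hi, hj, hi', hj', hi'', hj'', hA⟩ := hm i j
    calc (Fintype.card (Perm ι) : ℝ) * ∑ ρ, (W (ρ * swap i j) - W ρ) *
          (Real.exp (s * W (ρ * swap i j)) - Real.exp (s * W ρ))
        ≤ Fintype.card (Perm ι) * (s * ∑ ρ, (W (ρ * swap i j) - W ρ) ^ 2 *
          max (Real.exp (s * W (ρ * swap i j))) (Real.exp (s * W ρ))) := by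
          gcongr
          rw [Finset.mul_sum]
          exact Finset.sum_le_sum fun ρ _ => sub_mul_exp_sub_le hs _ _
      _ = s * ∑ σ, ∑ ρ, (W (ρ * swap i j) - W ρ) ^ 2 *
          max (Real.exp (s * W (steer ρ A.toList σ * swap i j)))
            (Real.exp (s * W (steer ρ A.toList σ))) := by
          rw [sum_sum_steer A.toList (fun ρ => (W (ρ * swap i j) - W ρ) ^ 2)
            (fun ρ => max (Real.exp (s * W (ρ * swap i j))) (Real.exp (s * W ρ)))]
          · ring
          · intro ρ h hh
            rw [hW, relabelStat_swap_sub_mul d hi hj hi' hj' hi'' hj'' ρ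
              fun x hx => hh x (by simpa using hx)]
      _ ≤ s * ∑ σ, ∑ ρ, (W (ρ * swap i j) - W ρ) ^ 2 * (E * Real.exp (s * W σ)) := by
          gcongr with σ _ ρ _
          obtain ⟨h1, h2⟩ := abs_relabelStat_steer_sub_le hda hA hi hj ha ρ σ
          rw [← Real.exp_add]
          apply max_le <;> apply Real.exp_le_exp.2
          · nlinarith [(abs_le.1 h2).2]
          · nlinarith [(abs_le.1 h1).2]
      _ = s * E * (∑ ρ, (W (ρ * swap i j) - W ρ) ^ 2) * ∑ σ, Real.exp (s * W σ) := by
          simp only [← Finset.sum_mul, ← Finset.mul_sum]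
          ring
  have hn : (0 : ℝ) < 8 * ((Fintype.card ι : ℝ) - 1) := by
    have : (1 : ℝ) < Fintype.card ι := by exact_mod_cast hcard
    linarith
  have st1 := stein_identity hd hτ fun w => Real.exp (s * w)
  have st2 := stein_identity hd hτ id
  simp only [id, ← hW, ← sq] at st1 st2
  refine le_of_mul_le_mul_left ?_ hn
  calc 8 * ((Fintype.card ι : ℝ) - 1) * (Fintype.card (Perm ι) * ∑ σ, W σ * Real.exp (s * W σ))
      = ∑ i, ∑ j, Fintype.card (Perm ι) * ∑ ρ, (W (ρ * swap i j) - W ρ) *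
        (Real.exp (s * W (ρ * swap i j)) - Real.exp (s * W ρ)) := by
        simp only [← Finset.mul_sum, st1]
        ring
    _ ≤ ∑ i, ∑ j, s * E * (∑ ρ, (W (ρ * swap i j) - W ρ) ^ 2) * ∑ σ, Real.exp (s * W σ) :=
        Finset.sum_le_sum fun i _ => Finset.sum_le_sum fun j _ => key i j
    _ = _ := by
        simp only [← Finset.mul_sum, ← Finset.sum_mul, st2]
        ring

end

/-! ### Second moments -/

section

variable {ι : Type*} [Fintype ι] [DecidableEq ι]

theorem sum_eq_sum_add_mul {f : ι → ℝ} {K : Finset ι} {c : ℝ} (h : ∀ w ∉ K, f w = c) :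
    ∑ w, f w = ∑ w ∈ K, f w + ((Fintype.card ι : ℝ) - K.card) * c := by
  rw [← Finset.sum_add_sum_compl K, Finset.sum_congr rfl fun w hw => h w (Finset.mem_compl.1 hw),
    Finset.sum_const, nsmul_eq_mul, Finset.card_compl, Nat.cast_sub (Finset.card_le_univ _)]

theorem sum_mul_swap (f : Perm ι → ℝ) (w w' : ι) : ∑ σ, f (σ * swap w w') = ∑ σ, f σ :=
  Equiv.sum_comp (Equiv.mulRight (swap w w')) f

theorem sum_apply_apply_eq_zero {d : ι → ι → ℝ} (hd : IsCentred d) {x y : ι} (hxy : x ≠ y) :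
    ∑ σ : Perm ι, d (σ x) (σ y) = 0 := by
  have h1 : ∀ w ∉ ({x} : Finset ι), ∑ σ : Perm ι, d (σ x) (σ w) = ∑ σ : Perm ι, d (σ x) (σ y) := by
    intro w hw
    rw [Finset.mem_singleton] at hw
    rw [← sum_mul_swap _ y w]
    refine Finset.sum_congr rfl fun σ _ => ?_
    simp [swap_apply_of_ne_of_ne hxy (Ne.symm hw)]
  have h2 := sum_eq_sum_add_mul h1
  rw [Finset.sum_comm] at h2
  simp only [(hd.relabel _).row, Finset.sum_const_zero, Finset.sum_singleton, hd.diag,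
    Finset.card_singleton, zero_add, Nat.cast_one] at h2
  have : 1 < Fintype.card ι := Fintype.one_lt_card_iff.2 ⟨x, y, hxy⟩
  have : (1 : ℝ) < Fintype.card ι := by exact_mod_cast this
  rcases mul_eq_zero.1 h2.symm with h | h
  · linarith
  · exact h

/-- `n!` times the correlation of the entries at the random positions `(σ x, σ y)` and
`(σ z, σ w)`. -/
def entryCorr (d : ι → ι → ℝ) (x y z w : ι) : ℝ :=
  ∑ σ : Perm ι, d (σ x) (σ y) * d (σ z) (σ w)

theorem sum_relabelStat_sq (d : ι → ι → ℝ) (τ : Perm ι) :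
    ∑ σ, relabelStat d τ σ ^ 2 = ∑ x, ∑ y, entryCorr d x (τ x) y (τ y) := by
  simp only [relabelStat, sq, Finset.sum_mul_sum, entryCorr]
  rw [Finset.sum_comm]
  exact Finset.sum_congr rfl fun x _ => Finset.sum_comm

section Corr

variable {d : ι → ι → ℝ}

theorem entryCorr_comm_left (hd : IsCentred d) (x y z w : ι) : entryCorr d x y z w = entryCorr d y x z w :=
  Finset.sum_congr rfl fun σ _ => by rw [hd.symm]

theorem entryCorr_comm_right (hd : IsCentred d) (x y z w : ι) : entryCorr d x y z w = entryCorr d x y w z :=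
  Finset.sum_congr rfl fun σ _ => by rw [hd.symm (σ z)]

theorem entryCorr_diag (hd : IsCentred d) (x y z : ι) : entryCorr d x y z z = 0 := by
  simp [entryCorr, hd.diag]

theorem sum_entryCorr (hd : IsCentred d) (x y z : ι) : ∑ w, entryCorr d x y z w = 0 := by
  simp only [entryCorr]
  rw [Finset.sum_comm]
  simp only [← Finset.mul_sum, (hd.relabel _).row, mul_zero, Finset.sum_const_zero]

theorem entryCorr_swap {x y z w w' : ι} (hx : w ≠ x ∧ w' ≠ x) (hy : w ≠ y ∧ w' ≠ y)
    (hz : w ≠ z ∧ w' ≠ z) : entryCorr d x y z w' = entryCorr d x y z w := by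
  unfold entryCorr
  rw [← sum_mul_swap _ w w']
  refine Finset.sum_congr rfl fun σ _ => ?_
  simp [swap_apply_of_ne_of_ne hx.1.symm hx.2.symm, swap_apply_of_ne_of_ne hy.1.symm hy.2.symm,
    swap_apply_of_ne_of_ne hz.1.symm hz.2.symm]

theorem entryCorr_self (hd : IsCentred d) {x y : ι} (hxy : x ≠ y) :
    (Fintype.card ι : ℝ) * ((Fintype.card ι : ℝ) - 1) * entryCorr d x y x y
      = Fintype.card (Perm ι) * ∑ i, ∑ j, d i j ^ 2 := by
  set R : ι → ℝ := fun i => ∑ j, d i j ^ 2 with hR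
  have h1 : ∀ w ∉ ({x} : Finset ι), entryCorr d x w x w = entryCorr d x y x y := by
    intro w hw
    rw [Finset.mem_singleton] at hw
    unfold entryCorr
    rw [← sum_mul_swap _ y w]
    refine Finset.sum_congr rfl fun σ _ => ?_
    simp [swap_apply_of_ne_of_ne hxy (Ne.symm hw)]
  have h2 := sum_eq_sum_add_mul h1
  have h3 : ∑ w, entryCorr d x w x w = ∑ σ : Perm ι, R (σ x) := by
    unfold entryCorr
    rw [Finset.sum_comm]
    refine Finset.sum_congr rfl fun σ _ => ?_
    simp only [hR, ← sq]
    exact Equiv.sum_comp σ fun j => d (σ x) j ^ 2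
  have h4 : ∀ x', ∑ σ : Perm ι, R (σ x') = ∑ σ : Perm ι, R (σ x) := fun x' => by
    rw [← sum_mul_swap (fun σ => R (σ x')) x x']
    simp
  have h5 : (Fintype.card ι : ℝ) * ∑ σ : Perm ι, R (σ x) = Fintype.card (Perm ι) * ∑ i, R i := by
    have : ∑ x', ∑ σ : Perm ι, R (σ x') = Fintype.card (Perm ι) * ∑ i, R i := by
      rw [Finset.sum_comm]
      simp only [Equiv.sum_comp, Finset.sum_const, Finset.card_univ, nsmul_eq_mul]
    rw [← this, Finset.sum_congr rfl fun x' _ => h4 x', Finset.sum_const, Finset.card_univ,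
      nsmul_eq_mul]
  rw [h3, Finset.sum_singleton, entryCorr_diag hd, Finset.card_singleton] at h2
  rw [← h5, h2]
  push_cast
  ring

/-- Moving the last index over all points gives a vanishing row sum, in which the entries with a
new last index are equal. -/
theorem entryCorr_adjacent (hd : IsCentred d) {x y z : ι} (hxy : x ≠ y) (hxz : x ≠ z) (hyz : y ≠ z) :
    ((Fintype.card ι : ℝ) - 2) * entryCorr d x y y z = -entryCorr d x y x y := by
  have h1 : ∀ w ∉ ({x, y} : Finset ι), entryCorr d x y y w = entryCorr d x y y z := by
    intro w hw
    simp only [Finset.mem_insert, Finset.mem_singleton, not_or] at hw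
    exact entryCorr_swap ⟨hxz.symm, hw.1⟩ ⟨hyz.symm, hw.2⟩ ⟨hyz.symm, hw.2⟩
  have h2 := sum_eq_sum_add_mul h1
  rw [sum_entryCorr hd, Finset.sum_pair hxy, entryCorr_diag hd, entryCorr_comm_right hd x y y x,
    Finset.card_pair hxy] at h2
  push_cast at h2
  linarith

theorem entryCorr_disjoint (hd : IsCentred d) {x y z w : ι} (hxy : x ≠ y) (hxz : x ≠ z) (hyz : y ≠ z)
    (hxw : x ≠ w) (hyw : y ≠ w) (hzw : z ≠ w) :
    ((Fintype.card ι : ℝ) - 2) * ((Fintype.card ι : ℝ) - 3) * entryCorr d x y z w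
      = 2 * entryCorr d x y x y := by
  have h1 : ∀ u ∉ ({x, y, z} : Finset ι), entryCorr d x y z u = entryCorr d x y z w := by
    intro u hu
    simp only [Finset.mem_insert, Finset.mem_singleton, not_or] at hu
    exact entryCorr_swap ⟨hxw.symm, hu.1⟩ ⟨hyw.symm, hu.2.1⟩ ⟨hzw.symm, hu.2.2⟩
  have h2 := sum_eq_sum_add_mul h1
  have h3 := entryCorr_adjacent hd hxy hxz hyz
  have h4 := entryCorr_adjacent hd hxy.symm hyz hxz
  rw [entryCorr_comm_left hd y x y x, entryCorr_comm_right hd x y y x, entryCorr_comm_left hd y x,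
    entryCorr_comm_right hd x y x z] at h4
  rw [sum_entryCorr hd, Finset.sum_insert (by simp [hxy, hxz]), Finset.sum_pair hyz,
    entryCorr_diag hd, entryCorr_comm_right hd x y z y,
    Finset.card_eq_three.2 ⟨x, y, z, hxy, hxz, hyz, rfl⟩] at h2
  push_cast at h2
  linear_combination -((Fintype.card ι : ℝ) - 2) * h2 - h3 - h4

theorem sum_relabelStat (hd : IsCentred d) {τ : Perm ι} (hτ : ∀ x, τ x ≠ x) : ∑ σ, relabelStat d τ σ = 0 := by
  unfold relabelStat
  rw [Finset.sum_comm]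
  exact Finset.sum_eq_zero fun x _ => sum_apply_apply_eq_zero hd (hτ x).symm

theorem sum_relabelStat_sq_of_involution (hd : IsCentred d) (hn : 4 ≤ Fintype.card ι) {τ : Perm ι}
    (hτ : ∀ x, τ x ≠ x) (hinv : ∀ x, τ (τ x) = x) :
    ∑ σ, relabelStat d τ σ ^ 2 = Fintype.card (Perm ι) *
      (2 * ((Fintype.card ι : ℝ) - 2) / (((Fintype.card ι : ℝ) - 1) * ((Fintype.card ι : ℝ) - 3))
        * ∑ i, ∑ j, d i j ^ 2) := by
  have hn' : (4 : ℝ) ≤ Fintype.card ι := by exact_mod_cast hn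
  set N : ℝ := (Fintype.card ι : ℝ) with hN
  have e0 : N ≠ 0 := by linarith
  have e1 : N - 1 ≠ 0 := by linarith
  have e2 : N - 2 ≠ 0 := by linarith
  have e3 : N - 3 ≠ 0 := by linarith
  set V : ℝ := Fintype.card (Perm ι) * ∑ i, ∑ j, d i j ^ 2 with hV
  have hself : ∀ x, entryCorr d x (τ x) x (τ x) = V / (N * (N - 1)) := fun x => by
    rw [eq_div_iff (mul_ne_zero e0 e1), hV, ← entryCorr_self hd (hτ x).symm]; ring
  have row : ∀ x, ∑ y, entryCorr d x (τ x) y (τ y)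
      = 2 * (V / (N * (N - 1))) * ((N - 2) / (N - 3)) := by
    intro x
    have h1 : ∀ y ∉ ({x, τ x} : Finset ι), entryCorr d x (τ x) y (τ y)
        = 2 * (V / (N * (N - 1))) / ((N - 2) * (N - 3)) := by
      intro y hy
      simp only [Finset.mem_insert, Finset.mem_singleton, not_or] at hy
      rw [← hself x, eq_div_iff (mul_ne_zero e2 e3), ← entryCorr_disjoint hd (hτ x).symm
        (Ne.symm hy.1) (Ne.symm hy.2) (w := τ y)]
      · ring
      · intro h; exact hy.2 (by rw [h, hinv])
      · intro h; exact hy.1 (τ.injective h).symm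
      · exact (hτ y).symm
    rw [sum_eq_sum_add_mul h1, Finset.sum_pair (hτ x).symm, Finset.card_pair (hτ x).symm, hinv,
      entryCorr_comm_right hd x (τ x) (τ x) x, hself, ← hN]
    push_cast
    field_simp
    ring
  rw [sum_relabelStat_sq]
  simp only [row, Finset.sum_const, Finset.card_univ, nsmul_eq_mul, ← hN, hV]
  field_simp

theorem sum_relabelStat_sq_of_long_cycles (hd : IsCentred d) (hn : 4 ≤ Fintype.card ι) {τ : Perm ι}
    (hτ : ∀ x, τ x ≠ x) (hτ2 : ∀ x, τ (τ x) ≠ x) :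
    ∑ σ, relabelStat d τ σ ^ 2 = Fintype.card (Perm ι) *
      (1 / ((Fintype.card ι : ℝ) - 1) * ∑ i, ∑ j, d i j ^ 2) := by
  have hn' : (4 : ℝ) ≤ Fintype.card ι := by exact_mod_cast hn
  set N : ℝ := (Fintype.card ι : ℝ) with hN
  have e0 : N ≠ 0 := by linarith
  have e1 : N - 1 ≠ 0 := by linarith
  have e2 : N - 2 ≠ 0 := by linarith
  have e3 : N - 3 ≠ 0 := by linarith
  set V : ℝ := Fintype.card (Perm ι) * ∑ i, ∑ j, d i j ^ 2 with hV
  have hself : ∀ x, entryCorr d x (τ x) x (τ x) = V / (N * (N - 1)) := fun x => by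
    rw [eq_div_iff (mul_ne_zero e0 e1), hV, ← entryCorr_self hd (hτ x).symm]; ring
  have row : ∀ x, ∑ y, entryCorr d x (τ x) y (τ y) = V / (N * (N - 1)) := by
    intro x
    obtain ⟨z, rfl⟩ := τ.surjective x
    have hz : z ≠ τ (τ z) := (hτ2 z).symm
    have h1 : ∀ y ∉ ({τ z, τ (τ z), z} : Finset ι), entryCorr d (τ z) (τ (τ z)) y (τ y)
        = 2 * (V / (N * (N - 1))) / ((N - 2) * (N - 3)) := by
      intro y hy
      simp only [Finset.mem_insert, Finset.mem_singleton, not_or] at hy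
      rw [← hself (τ z), eq_div_iff (mul_ne_zero e2 e3), ← entryCorr_disjoint hd (hτ (τ z)).symm
        (Ne.symm hy.1) (Ne.symm hy.2.1) (w := τ y)]
      · ring
      · intro h; exact hy.2.2 (τ.injective h).symm
      · intro h; exact hy.1 (τ.injective h).symm
      · exact (hτ y).symm
    have h2 : entryCorr d (τ z) (τ (τ z)) (τ (τ z)) (τ (τ (τ z)))
        = -(V / (N * (N - 1))) / (N - 2) := by
      rw [eq_div_iff e2, ← hself (τ z), ← entryCorr_adjacent hd (hτ (τ z)).symm
        (hτ2 (τ z)).symm (hτ (τ (τ z))).symm]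
      ring
    have h3 : entryCorr d (τ z) (τ (τ z)) z (τ z) = -(V / (N * (N - 1))) / (N - 2) := by
      have h4 := entryCorr_adjacent hd (hτ (τ z)) hz.symm (hτ z)
      rw [entryCorr_comm_left hd, entryCorr_comm_right hd, entryCorr_comm_left hd (τ (τ z)) (τ z),
        entryCorr_comm_right hd (τ z) (τ (τ z)) (τ (τ z))] at h4
      rw [eq_div_iff e2, ← hself (τ z), ← h4]
      ring
    rw [sum_eq_sum_add_mul h1, Finset.card_eq_three.2 ⟨_, _, _, (hτ (τ z)).symm, hτ z, hτ2 z, rfl⟩,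
      Finset.sum_insert (by simp [hτ z, (hτ (τ z)).symm]), Finset.sum_pair (hτ2 z), hself, h2, h3,
      ← hN]
    push_cast
    field_simp
    ring
  rw [sum_relabelStat_sq]
  simp only [row, Finset.sum_const, Finset.card_univ, nsmul_eq_mul, ← hN, hV]
  field_simp

end Corr

end

/-! ### Tail bounds from the zero bias inequality -/

section Analysis

variable {κ : Type*} [Fintype κ]

/-- The zero bias inequality for the law `p` of `W`: the derivative of the moment generating
function is at most `s v e^{cs}` times the function itself. -/
def ExpBiasBound (p W : κ → ℝ) (v c : ℝ) : Prop :=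
  ∀ s, 0 ≤ s → ∑ k, p k * (W k * Real.exp (s * W k)) ≤
    s * Real.exp (c * s) * v * ∑ k, p k * Real.exp (s * W k)

theorem ExpBiasBound.mono {p W : κ → ℝ} {v c v' c' : ℝ} (hp : ∀ k, 0 ≤ p k)
    (h : ExpBiasBound p W v c) (hv : 0 ≤ v) (hvv' : v ≤ v') (hcc' : c ≤ c') :
    ExpBiasBound p W v' c' := by
  intro s hs
  refine (h s hs).trans ?_
  have : 0 ≤ ∑ k, p k * Real.exp (s * W k) :=
    Finset.sum_nonneg fun k _ => mul_nonneg (hp k) (Real.exp_pos _).le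
  gcongr

/-- Any primitive of a majorant of `s exp (c s)` bounds the logarithm of the moment generating
function, by Grönwall's argument. -/
theorem ExpBiasBound.mgf_le {p W : κ → ℝ} {v c : ℝ} (hp : ∀ k, 0 ≤ p k) (hp1 : ∑ k, p k = 1)
    (hv : 0 ≤ v) (h : ExpBiasBound p W v c) {S : ℝ} (hS : 0 ≤ S) {g g' : ℝ → ℝ}
    (hg : ∀ s ∈ Set.Icc 0 S, HasDerivAt g (g' s) s)
    (hg' : ∀ s ∈ Set.Icc 0 S, s * Real.exp (c * s) ≤ g' s) :
    ∑ k, p k * Real.exp (S * W k) ≤ Real.exp (v * (g S - g 0)) := by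
  set M : ℝ → ℝ := fun s => ∑ k, p k * Real.exp (s * W k) with hM
  have hM0 : M 0 = 1 := by simp [hM, hp1]
  have hMnn : ∀ s, 0 ≤ M s := fun s =>
    Finset.sum_nonneg fun k _ => mul_nonneg (hp k) (Real.exp_pos _).le
  have hMd : ∀ s, HasDerivAt M (∑ k, p k * (W k * Real.exp (s * W k))) s := fun s => by
    refine HasDerivAt.fun_sum fun k _ => ?_
    refine ((((hasDerivAt_id s).mul_const (W k)).exp).const_mul (p k)).congr_deriv ?_
    simp only [id]; ring
  set G : ℝ → ℝ := fun s => M s * Real.exp (-(v * (g s - g 0))) with hG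
  have hGd : ∀ s ∈ Set.Icc 0 S, HasDerivAt G
      ((∑ k, p k * (W k * Real.exp (s * W k)) - v * g' s * M s)
        * Real.exp (-(v * (g s - g 0)))) s := fun s hs => by
    have h1 : HasDerivAt (fun s => -(v * (g s - g 0))) (-(v * g' s)) s :=
      (((hg s hs).sub_const (g 0)).const_mul v).neg
    exact ((hMd s).mul h1.exp).congr_deriv (by ring)
  have hanti : AntitoneOn G (Set.Icc 0 S) := by
    refine antitoneOn_of_hasDerivWithinAt_nonpos (convex_Icc 0 S)
      (fun s hs => (hGd s hs).continuousAt.continuousWithinAt)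
      (fun s hs => (hGd s (interior_subset hs)).hasDerivWithinAt) fun s hs => ?_
    have hs' := interior_subset hs
    refine mul_nonpos_of_nonpos_of_nonneg ?_ (Real.exp_pos _).le
    have h1 := h s hs'.1
    have h2 : s * Real.exp (c * s) * v * M s ≤ v * g' s * M s := by
      have := mul_le_mul_of_nonneg_left (hg' s hs') hv
      exact mul_le_mul_of_nonneg_right (by linarith) (hMnn s)
    linarith
  have := hanti (Set.left_mem_Icc.2 hS) (Set.right_mem_Icc.2 hS) hS
  simp only [hG, sub_self, mul_zero, neg_zero, Real.exp_zero, mul_one, hM0] at this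
  rwa [Real.exp_neg, mul_inv_le_iff₀ (Real.exp_pos _), one_mul] at this

/-- The bounds `B(v, c)` for the right tail of the law `p` of `W`. -/
structure RightTailBounds (p W : κ → ℝ) (v c : ℝ) : Prop where
  one : ∀ t, 0 ≤ t → ∑ k with t ≤ W k, p k ≤ Real.exp (-(t ^ 2 / (2 * (v + c * t))))
  two : ∀ t, 0 ≤ t → ∑ k with t ≤ W k, p k ≤ Real.exp (-(t ^ 2 / (10 * v / 3 + c * t)))
  log : ∀ t, Real.exp 1 < t → ∑ k with t ≤ W k, p k ≤
    Real.exp (-(t / c) * (Real.log t - Real.log (Real.log t) - v / c))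

theorem sum_filter_le_exp_mul {p W : κ → ℝ} (hp : ∀ k, 0 ≤ p k) {s : ℝ} (hs : 0 ≤ s) (t : ℝ) :
    ∑ k with t ≤ W k, p k ≤ Real.exp (-(s * t)) * ∑ k, p k * Real.exp (s * W k) := by
  rw [Finset.mul_sum, Finset.sum_filter]
  refine Finset.sum_le_sum fun k _ => ?_
  split_ifs with h
  · have h1 : 1 ≤ Real.exp (-(s * t)) * Real.exp (s * W k) := by
      rw [← Real.exp_add]; exact Real.one_le_exp (by nlinarith)
    nlinarith [hp k]
  · have := hp k; positivity

theorem exp_mul_le_one_div {x y : ℝ} (hx : 0 ≤ x) (hxy : x ≤ y) (hy : y < 1) :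
    Real.exp x ≤ 1 / (1 - y) :=
  (Real.exp_bound_div_one_sub_of_interval hx (hxy.trans_lt hy)).trans
    (one_div_le_one_div_of_le (by linarith) (by linarith))

theorem exp_le_of_lt_two {x : ℝ} (hx : 0 ≤ x) (hx2 : x < 2) :
    Real.exp x ≤ 5 / 3 * (4 - x) / (2 - x) ^ 2 := by
  have hpos : 0 < 2 - x := by linarith
  rw [le_div_iff₀ (by positivity)]
  rcases le_or_gt x (8 / 5) with h | h
  · -- Here `exp (x / 2) ≤ 1 / (1 - x / 2)` suffices.
    have h1 := Real.exp_bound_div_one_sub_of_interval (x := x / 2) (by linarith) (by linarith)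
    have h2 : Real.exp (x / 2) * (2 - x) ≤ 2 := by
      rw [le_div_iff₀ (by linarith)] at h1; linarith
    have h3 : Real.exp x = Real.exp (x / 2) * Real.exp (x / 2) := by
      rw [← Real.exp_add]; ring_nf
    have h4 : 0 ≤ Real.exp (x / 2) * (2 - x) := by positivity
    rw [h3]
    nlinarith
  · have h1 : Real.exp x ≤ 9 := by
      calc Real.exp x ≤ Real.exp (1 + 1) := Real.exp_le_exp.2 (by linarith)
        _ = Real.exp 1 * Real.exp 1 := Real.exp_add _ _
        _ ≤ 3 * 3 := by
          have := Real.exp_one_lt_d9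
          gcongr <;> linarith
        _ = 9 := by norm_num
    have h2 : (2 - x) ^ 2 ≤ 0.16 := by nlinarith
    nlinarith [Real.exp_pos x]

theorem ExpBiasBound.rightTailBounds {p W : κ → ℝ} {v c : ℝ} (hp : ∀ k, 0 ≤ p k)
    (hp1 : ∑ k, p k = 1) (hv : 0 < v) (hc : 0 < c) (h : ExpBiasBound p W v c) :
    RightTailBounds p W v c := by
  have chernoff : ∀ {S t r : ℝ}, 0 ≤ S → ∀ g g' : ℝ → ℝ,
      (∀ s ∈ Set.Icc 0 S, HasDerivAt g (g' s) s) →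
      (∀ s ∈ Set.Icc 0 S, s * Real.exp (c * s) ≤ g' s) → v * (g S - g 0) - S * t ≤ r →
      ∑ k with t ≤ W k, p k ≤ Real.exp r := by
    intro S t r hS g g' hg hg' hr
    calc ∑ k with t ≤ W k, p k
        ≤ Real.exp (-(S * t)) * ∑ k, p k * Real.exp (S * W k) := sum_filter_le_exp_mul hp hS t
      _ ≤ Real.exp (-(S * t)) * Real.exp (v * (g S - g 0)) := by
          gcongr; exact h.mgf_le hp hp1 hv.le hS hg hg'
      _ ≤ Real.exp r := by
          rw [← Real.exp_add]; exact Real.exp_le_exp.2 (by linarith)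
  refine ⟨fun t ht => ?_, fun t ht => ?_, fun t ht => ?_⟩
  · -- Majorant: `s / (1 - c S)`, where `v S = t (1 - c S)`; the exponent at `S` is `-S t / 2`.
    have hD : 0 < v + c * t := by positivity
    set S := t / (v + c * t) with hSdef
    have hS : 0 ≤ S := by positivity
    have hcS : 1 - c * S = v / (v + c * t) := by rw [hSdef]; field_simp; ring
    have hcS' : 0 < 1 - c * S := by rw [hcS]; positivity
    refine chernoff hS (fun s => s ^ 2 / (2 * (1 - c * S))) (fun s => s / (1 - c * S))
      (fun s _ => ?_) (fun s hs => ?_) (le_of_eq ?_)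
    · refine ((hasDerivAt_pow 2 s).div_const (2 * (1 - c * S))).congr_deriv ?_
      field_simp; simp
    · have := exp_mul_le_one_div (x := c * s) (y := c * S) (mul_nonneg hc.le hs.1)
        (mul_le_mul_of_nonneg_left hs.2 hc.le) (by linarith)
      calc s * Real.exp (c * s) ≤ s * (1 / (1 - c * S)) := mul_le_mul_of_nonneg_left this hs.1
        _ = _ := by ring
    · rw [hcS, hSdef]; field_simp; ring
  · -- Majorant: the derivative of `(5 / 3) s² / (2 - c s)`; the exponent at `S` is `-S t / 2`.
    have hD : 0 < 10 * v / 3 + c * t := by positivity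
    set S := 2 * t / (10 * v / 3 + c * t) with hSdef
    have hS : 0 ≤ S := by positivity
    have hcS : 2 - c * S = 2 * (10 * v / 3) / (10 * v / 3 + c * t) := by
      rw [hSdef, eq_div_iff hD.ne']
      have : 2 * t / (10 * v / 3 + c * t) * (10 * v / 3 + c * t) = 2 * t :=
        div_mul_cancel₀ _ hD.ne'
      linear_combination -c * this
    have hcS' : 0 < 2 - c * S := by rw [hcS]; positivity
    have hpos : ∀ s ∈ Set.Icc 0 S, 0 < 2 - c * s := fun s hs => by nlinarith [hs.2]
    refine chernoff hS (fun s => 5 / 3 * s ^ 2 / (2 - c * s))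
      (fun s => s * (5 / 3 * (4 - c * s) / (2 - c * s) ^ 2))
      (fun s hs => ?_) (fun s hs => ?_) (le_of_eq ?_)
    · have h1 : HasDerivAt (fun s : ℝ => 5 / 3 * s ^ 2) (5 / 3 * (2 * s)) s := by
        refine ((hasDerivAt_pow 2 s).const_mul (5 / 3 : ℝ)).congr_deriv ?_
        simp
      have h2 : HasDerivAt (fun s : ℝ => 2 - c * s) (-c) s := by
        refine (((hasDerivAt_id s).const_mul c).const_sub 2).congr_deriv ?_
        simp
      refine (h1.div h2 (hpos s hs).ne').congr_deriv ?_
      have := (hpos s hs).ne'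
      field_simp; ring
    · exact mul_le_mul_of_nonneg_left
        (exp_le_of_lt_two (mul_nonneg hc.le hs.1) (by linarith [hpos s hs])) hs.1
    · rw [hcS, hSdef]; field_simp; ring
  · -- Majorant: the derivative of `s exp (c s) / c`. The choice of `S` makes
    -- `exp (c S) = t / log t`.
    have ht0 : 0 < t := (Real.exp_pos 1).trans ht
    have hL : 1 < Real.log t := by rwa [Real.lt_log_iff_exp_lt ht0]
    have hLL : 0 ≤ Real.log (Real.log t) := Real.log_nonneg hL.le
    have hle : Real.log (Real.log t) ≤ Real.log t := by
      linarith [Real.log_le_sub_one_of_pos (show 0 < Real.log t by linarith)]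
    set S := (Real.log t - Real.log (Real.log t)) / c with hSdef
    have hS : 0 ≤ S := div_nonneg (by linarith) hc.le
    have hE : Real.exp (c * S) = t / Real.log t := by
      rw [hSdef, mul_div_cancel₀ _ hc.ne', Real.exp_sub, Real.exp_log ht0,
        Real.exp_log (by linarith)]
    refine chernoff hS (fun s => s * Real.exp (c * s) / c)
      (fun s => Real.exp (c * s) / c + s * Real.exp (c * s))
      (fun s hs => ?_) (fun s hs => ?_) ?_
    · have h2 : HasDerivAt (fun s : ℝ => Real.exp (c * s)) (Real.exp (c * s) * c) s := by
        refine (((hasDerivAt_id s).const_mul c).exp).congr_deriv ?_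
        simp
      refine (((hasDerivAt_id s).mul h2).div_const c).congr_deriv ?_
      simp only [id]; field_simp
    · have := Real.exp_pos (c * s)
      have : 0 ≤ Real.exp (c * s) / c := by positivity
      linarith
    · simp only [hE, zero_mul, zero_div, sub_zero]
      have h1 : v * (S * (t / Real.log t) / c) ≤ v * (t / c / c) := by
        have h2 : S * (t / Real.log t) ≤ t / c := by
          rw [hSdef, div_mul_div_comm, div_le_div_iff₀ (by positivity) hc]
          have : 0 ≤ c * t * Real.log (Real.log t) := by positivity
          nlinarith
        gcongr
      have h3 : -(t / c) * (Real.log t - Real.log (Real.log t) - v / c)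
          = v * (t / c / c) - S * t := by
        rw [hSdef]; field_simp; ring
      rw [h3]; linarith

theorem exp_log_bound_le {v c t : ℝ} (hc : 0 < c) (ht : Real.exp 1 < t) :
    Real.exp (-(t / c) * (Real.log t - Real.log (Real.log t) - v / c)) ≤
      Real.exp (-(t / (2 * c)) * (Real.log t - 2 * v / c)) := by
  have ht0 : 0 < t := (Real.exp_pos 1).trans ht
  have hL : 1 < Real.log t := by rwa [Real.lt_log_iff_exp_lt ht0]
  have hLL : Real.log (Real.log t) ≤ Real.log t / 2 := by
    have h1 := Real.log_le_sub_one_of_pos (show 0 < Real.log t / 2 by linarith)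
    have h2 : Real.log (Real.log t / 2) = Real.log (Real.log t) - Real.log 2 :=
      Real.log_div (by linarith) (by norm_num)
    linarith [Real.log_two_lt_d9]
  apply Real.exp_le_exp.2
  have h1 : -(t / (2 * c)) * (Real.log t - 2 * v / c) = -(t / c) * (Real.log t / 2 - v / c) := by
    field_simp
  have : 0 < t / c := by positivity
  rw [h1]; nlinarith

end Analysis

/-! ### Averaging over a conjugation invariant law -/

section Averaging

variable {ι : Type*} [Fintype ι] [DecidableEq ι] {d : ι → ι → ℝ} {p X : Perm ι → ℝ}

/-- Under a conjugation invariant law, a permutation may be relabelled uniformly at random. -/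
theorem card_mul_sum_mul_comp (hp : ∀ σ τ, p (σ * τ * σ⁻¹) = p τ)
    (hX : ∀ τ, p τ ≠ 0 → X τ = ∑ i, d i (τ i)) (G : ℝ → ℝ) :
    Fintype.card (Perm ι) * ∑ τ, p τ * G (X τ) = ∑ τ, p τ * ∑ σ, G (relabelStat d τ σ) := by
  have h1 : ∑ τ, p τ * G (X τ) = ∑ τ, p τ * G (∑ i, d i (τ i)) :=
    Finset.sum_congr rfl fun τ _ => by
      by_cases h : p τ = 0
      · simp [h]
      · rw [hX τ h]
  have h2 : ∀ σ : Perm ι, ∑ τ, p τ * G (relabelStat d τ σ) = ∑ τ, p τ * G (∑ i, d i (τ i)) := by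
    intro σ
    rw [← Equiv.sum_comp (MulAut.conj σ).toEquiv fun τ => p τ * G (∑ i, d i (τ i))]
    refine Finset.sum_congr rfl fun τ _ => ?_
    have h : (MulAut.conj σ).toEquiv τ = σ * τ * σ⁻¹ := rfl
    rw [h, hp, sum_apply_conj]
  simp only [Finset.mul_sum]
  rw [Finset.sum_comm (γ := Perm ι)]
  simp only [h2, ← Finset.mul_sum, h1, Finset.sum_const, Finset.card_univ, nsmul_eq_mul]

theorem sum_mul_stat_eq_zero (hd : IsCentred d) (hp : ∀ σ τ, p (σ * τ * σ⁻¹) = p τ)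
    (hX : ∀ τ, p τ ≠ 0 → X τ = ∑ i, d i (τ i)) (hfix : ∀ τ, p τ ≠ 0 → ∀ x, τ x ≠ x) :
    ∑ τ, p τ * X τ = 0 := by
  have h := card_mul_sum_mul_comp hp hX id
  have h0 : ∑ τ, p τ * ∑ σ, id (relabelStat d τ σ) = 0 := Finset.sum_eq_zero fun τ _ => by
    by_cases h : p τ = 0
    · simp [h]
    · simp [sum_relabelStat hd (hfix τ h)]
  rw [h0] at h
  exact (mul_eq_zero.1 h).resolve_left (by exact_mod_cast Fintype.card_ne_zero)

theorem sum_mul_stat_sq (hp : ∀ σ τ, p (σ * τ * σ⁻¹) = p τ) (hp1 : ∑ τ, p τ = 1)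
    (hX : ∀ τ, p τ ≠ 0 → X τ = ∑ i, d i (τ i)) {V : ℝ}
    (hV : ∀ τ, p τ ≠ 0 → ∑ σ, relabelStat d τ σ ^ 2 = Fintype.card (Perm ι) * V) :
    ∑ τ, p τ * X τ ^ 2 = V := by
  have h := card_mul_sum_mul_comp hp hX fun w => w ^ 2
  have h0 : ∑ τ, p τ * ∑ σ, relabelStat d τ σ ^ 2 = ∑ τ, p τ * (Fintype.card (Perm ι) * V) :=
    Finset.sum_congr rfl fun τ _ => by
      by_cases h : p τ = 0
      · simp [h]
      · rw [hV τ h]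
  rw [h0, ← Finset.sum_mul, hp1, one_mul] at h
  exact mul_left_cancel₀ (by exact_mod_cast Fintype.card_ne_zero) h

theorem expBiasBound_of_conj_invariant (hd : IsCentred d) {a : ℝ} (hda : ∀ i j, |d i j| ≤ a)
    (hcard : 1 < Fintype.card ι) (hp0 : ∀ τ, 0 ≤ p τ) (hp : ∀ σ τ, p (σ * τ * σ⁻¹) = p τ)
    (hX : ∀ τ, p τ ≠ 0 → X τ = ∑ i, d i (τ i)) (hfix : ∀ τ, p τ ≠ 0 → ∀ x, τ x ≠ x) {m : ℕ}
    (hm : ∀ τ, p τ ≠ 0 → HasSmallNeighbourhoods τ m) {V : ℝ}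
    (hV : ∀ τ, p τ ≠ 0 → ∑ σ, relabelStat d τ σ ^ 2 = Fintype.card (Perm ι) * V) :
    ExpBiasBound p X V (2 * a * m) := by
  intro s hs
  have hF : (0 : ℝ) < Fintype.card (Perm ι) := by exact_mod_cast Fintype.card_pos
  refine le_of_mul_le_mul_left ?_ hF
  rw [card_mul_sum_mul_comp hp hX fun w => w * Real.exp (s * w), mul_left_comm,
    card_mul_sum_mul_comp hp hX fun w => Real.exp (s * w), Finset.mul_sum]
  refine Finset.sum_le_sum fun τ _ => ?_
  by_cases h : p τ = 0
  · simp [h]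
  · have h1 := exp_bias_bound hd hda (hfix τ h) (hm τ h) hcard hs
    rw [hV τ h] at h1
    have h2 : ∑ σ, relabelStat d τ σ * Real.exp (s * relabelStat d τ σ) ≤
        s * Real.exp (2 * a * m * s) * V * ∑ σ, Real.exp (s * relabelStat d τ σ) := by
      refine le_of_mul_le_mul_left (h1.trans (le_of_eq ?_)) hF
      ring
    calc _ ≤ p τ * (s * Real.exp (2 * a * m * s) * V *
          ∑ σ, Real.exp (s * relabelStat d τ σ)) := mul_le_mul_of_nonneg_left h2 (hp0 τ)
      _ = _ := by ring

end Averaging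

/-! ### From finite sums to the probability space -/

section Law

variable {κ : Type*} [Fintype κ] {Ω : Type*} [MeasurableSpace Ω] (P : Measure Ω)
  [IsProbabilityMeasure P] {π : Ω → κ}

theorem integral_comp_eq_sum (hπ : ∀ k, MeasurableSet {ω | π ω = k}) (g : κ → ℝ) :
    ∫ ω, g (π ω) ∂P = ∑ k, P.real {ω | π ω = k} * g k := by
  let _ : MeasurableSpace κ := ⊤
  have hm : Measurable π := measurable_to_countable' hπ
  have : IsProbabilityMeasure (P.map π) := Measure.isProbabilityMeasure_map hm.aemeasurable
  rw [← integral_map (f := g) hm.aemeasurable (measurable_from_top.aestronglyMeasurable),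
    integral_fintype .of_finite]
  refine Finset.sum_congr rfl fun k _ => ?_
  rw [map_measureReal_apply hm (measurableSet_singleton k), smul_eq_mul]
  rfl

theorem measurable_comp_of_finite (hπ : ∀ k, MeasurableSet {ω | π ω = k}) (g : κ → ℝ) :
    Measurable fun ω => g (π ω) := by
  let _ : MeasurableSpace κ := ⊤
  exact (measurable_from_top (f := g)).comp (measurable_to_countable' hπ)

theorem measureReal_comp_eq_sum (hπ : ∀ k, MeasurableSet {ω | π ω = k})
    (Q : κ → Prop) [DecidablePred Q] : P.real {ω | Q (π ω)} = ∑ k with Q k, P.real {ω | π ω = k} := by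
  have h1 : {ω | Q (π ω)} = ⋃ k ∈ (Finset.univ.filter Q), {ω | π ω = k} := by
    ext ω; simp
  rw [h1, measureReal_biUnion_finset _ fun k _ => hπ k]
  intro k _ k' _ hkk'
  refine Set.disjoint_left.2 fun ω h h' => hkk' ?_
  exact (h : π ω = k).symm.trans h'

theorem tailBounds_of_expBiasBound (hπ : ∀ k, MeasurableSet {ω | π ω = k})
    (X : κ → ℝ) {v c : ℝ} (hv : 0 < v) (hc : 0 < c)
    (hr : ExpBiasBound (fun k => P.real {ω | π ω = k}) X v c)
    (hl : ExpBiasBound (fun k => P.real {ω | π ω = k}) (fun k => -X k) v c) :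
    TailBounds P (fun ω => X (π ω)) v c := by
  have hp1 : ∑ k, P.real {ω | π ω = k} = 1 := by
    have := integral_comp_eq_sum P hπ fun _ => 1
    simpa using this.symm
  have hR := hr.rightTailBounds (fun k => measureReal_nonneg) hp1 hv hc
  have hL := hl.rightTailBounds (fun k => measureReal_nonneg) hp1 hv hc
  have right : ∀ t, P.real {ω | t ≤ X (π ω)} = ∑ k with t ≤ X k, P.real {ω | π ω = k} := fun t => by
    exact measureReal_comp_eq_sum P hπ fun k => t ≤ X k
  have left : ∀ t, P.real {ω | X (π ω) ≤ -t} = ∑ k with t ≤ -X k, P.real {ω | π ω = k} :=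
    fun t => by
      simp only [le_neg]
      exact measureReal_comp_eq_sum P hπ fun k => X k ≤ -t
  exact
    { right_one := fun t ht => right t ▸ hR.one t ht
      left_one := fun t ht => left t ▸ hL.one t ht
      right_two := fun t ht => right t ▸ hR.two t ht
      left_two := fun t ht => left t ▸ hL.two t ht
      right_log := fun t ht => right t ▸ hR.log t ht
      left_log := fun t ht => left t ▸ hL.log t ht
      log_le := fun t ht => exp_log_bound_le hc ht }

end Law

/-! ### Centring the array -/

section Centring

variable {n : ℕ}

/-- The array `symmCentred a` with its diagonal replaced by zeros. -/
noncomputable def centredArray (a : Fin n → Fin n → ℝ) (i j : Fin n) : ℝ :=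
  if i = j then 0 else symmCentred a i j

theorem sum_offDiag (f : Fin n → Fin n → ℝ) :
    ∑ p : Fin n × Fin n with p.1 ≠ p.2, f p.1 p.2 = ∑ i, ∑ j, if i = j then 0 else f i j := by
  rw [Finset.sum_filter, Fintype.sum_prod_type]
  simp only [ne_eq, ite_not]

theorem sum_row (hn : 5 ≤ n) (a : Fin n → Fin n → ℝ) (i : Fin n) :
    ∑ j, (if i = j then 0 else a i j) = ((n : ℝ) - 2) * rowMean a i := by
  have : (5 : ℝ) ≤ n := by exact_mod_cast hn
  have h2 : (n : ℝ) - 2 ≠ 0 := by linarith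
  rw [rowMean, ← mul_assoc, mul_one_div_cancel h2, one_mul, Finset.sum_filter]
  simp only [ne_eq, ite_not, eq_comm]

theorem sum_rowMean (hn : 5 ≤ n) (a : Fin n → Fin n → ℝ) :
    ∑ i, rowMean a i = ((n : ℝ) - 1) * grandMean a := by
  have : (5 : ℝ) ≤ n := by exact_mod_cast hn
  have h1 : (n : ℝ) - 1 ≠ 0 := by linarith
  have h2 : (n : ℝ) - 2 ≠ 0 := by linarith
  apply mul_left_cancel₀ h2
  rw [grandMean, sum_offDiag a, Finset.mul_sum]
  simp only [sum_row hn, ← Finset.mul_sum]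
  field_simp

theorem isCentred_centredArray (hn : 5 ≤ n) {a : Fin n → Fin n → ℝ} (ha : ∀ i j, a i j = a j i) :
    IsCentred (centredArray a) where
  symm i j := by
    unfold centredArray symmCentred
    rw [ha i j]
    by_cases h : i = j
    · simp [h]
    · simp [h, Ne.symm h]; ring
  diag i := by simp [centredArray]
  row i := by
    have h1 : ∀ j, centredArray a i j = (if i = j then 0 else a i j) - rowMean a i - rowMean a j +
        grandMean a + (if i = j then 2 * rowMean a i - grandMean a else 0) := by
      intro j
      unfold centredArray symmCentred
      split_ifs with h
      · subst h; ring
      · ring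
    simp only [h1, Finset.sum_add_distrib, Finset.sum_sub_distrib, sum_row hn, sum_rowMean hn,
      Finset.sum_const, Finset.card_univ, Fintype.card_fin, nsmul_eq_mul, Finset.sum_ite_eq,
      Finset.mem_univ, if_true]
    ring

theorem hoeffdingStat_sub_meanConst (hn : 5 ≤ n) (a : Fin n → Fin n → ℝ) {τ : Perm (Fin n)}
    (hτ : ∀ x, τ x ≠ x) :
    hoeffdingStat a τ - meanConst a = ∑ i, centredArray a i (τ i) := by
  have h1 : ∀ i, centredArray a i (τ i)
      = a i (τ i) - rowMean a i - rowMean a (τ i) + grandMean a := fun i => by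
    rw [centredArray, if_neg (hτ i).symm, symmCentred]
  simp only [h1, Finset.sum_add_distrib, Finset.sum_sub_distrib, Equiv.sum_comp τ (rowMean a),
    sum_rowMean hn, Finset.sum_const, Finset.card_univ, Fintype.card_fin, nsmul_eq_mul,
    hoeffdingStat, meanConst]
  ring

theorem sum_centredArray_sq (a : Fin n → Fin n → ℝ) :
    ∑ i, ∑ j, centredArray a i j ^ 2 = offDiagSq (symmCentred a) := by
  rw [offDiagSq, sum_offDiag fun i j => symmCentred a i j ^ 2]
  refine Finset.sum_congr rfl fun i _ => Finset.sum_congr rfl fun j _ => ?_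
  unfold centredArray
  split_ifs <;> simp

theorem abs_le_offDiagMax (d : Fin n → Fin n → ℝ) {i j : Fin n} (h : i ≠ j) :
    |d i j| ≤ offDiagMax d :=
  le_ciSup (f := fun p : {p : Fin n × Fin n // p.1 ≠ p.2} => |d p.1.1 p.1.2|)
    (Set.finite_range _).bddAbove ⟨(i, j), h⟩

theorem offDiagMax_nonneg (d : Fin n → Fin n → ℝ) : 0 ≤ offDiagMax d :=
  Real.iSup_nonneg fun _ => abs_nonneg _

theorem offDiagSq_nonneg (d : Fin n → Fin n → ℝ) : 0 ≤ offDiagSq d :=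
  Finset.sum_nonneg fun _ _ => sq_nonneg _

theorem offDiagMax_pos {d : Fin n → Fin n → ℝ} (h : offDiagSq d ≠ 0) : 0 < offDiagMax d := by
  refine (offDiagMax_nonneg d).lt_of_ne fun h0 => h ?_
  refine Finset.sum_eq_zero fun p hp => ?_
  have h1 := abs_le_offDiagMax d (Finset.mem_filter.1 hp).2
  rw [← h0] at h1
  simp [abs_nonpos_iff.1 h1]

theorem abs_centredArray_le (a : Fin n → Fin n → ℝ) (i j : Fin n) :
    |centredArray a i j| ≤ offDiagMax (symmCentred a) := by
  unfold centredArray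
  split_ifs with h
  · simpa using offDiagMax_nonneg _
  · exact abs_le_offDiagMax _ h

/-- `symmCentred a` is the symmetrisation of `rowCentred a`. -/
theorem symmCentred_eq {a : Fin n → Fin n → ℝ} (ha : ∀ i j, a i j = a j i) (i j : Fin n) :
    symmCentred a i j = (rowCentred a i j + rowCentred a j i) / 2 := by
  unfold symmCentred rowCentred
  rw [ha j i]; ring

theorem offDiagSq_symmCentred_le {a : Fin n → Fin n → ℝ} (ha : ∀ i j, a i j = a j i) :
    offDiagSq (symmCentred a) ≤ offDiagSq (rowCentred a) := by
  have h1 : offDiagSq (rowCentred a)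
      = ∑ i, ∑ j, if i = j then 0 else rowCentred a j i ^ 2 := by
    rw [offDiagSq, sum_offDiag fun i j => rowCentred a i j ^ 2, Finset.sum_comm]
    simp only [eq_comm]
  have h2 : offDiagSq (rowCentred a)
      = ∑ i, ∑ j, if i = j then 0 else rowCentred a i j ^ 2 :=
    sum_offDiag fun i j => rowCentred a i j ^ 2
  have h3 : offDiagSq (symmCentred a) ≤ ∑ i, ∑ j, 1 / 2 *
      ((if i = j then 0 else rowCentred a i j ^ 2) + if i = j then 0 else rowCentred a j i ^ 2) := by
    rw [offDiagSq, sum_offDiag fun i j => symmCentred a i j ^ 2]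
    refine Finset.sum_le_sum fun i _ => Finset.sum_le_sum fun j _ => ?_
    split_ifs
    · simp
    · rw [symmCentred_eq ha]
      nlinarith [sq_nonneg (rowCentred a i j - rowCentred a j i)]
  simp only [← Finset.mul_sum, Finset.sum_add_distrib, ← h1, ← h2] at h3
  linarith

theorem offDiagMax_symmCentred_le {a : Fin n → Fin n → ℝ} (ha : ∀ i j, a i j = a j i) :
    offDiagMax (symmCentred a) ≤ offDiagMax (rowCentred a) := by
  refine Real.iSup_le (fun p => ?_) (offDiagMax_nonneg _)
  rw [symmCentred_eq ha, abs_div, abs_two]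
  have h1 := abs_le_offDiagMax (rowCentred a) p.2
  have h2 := abs_le_offDiagMax (rowCentred a) p.2.symm
  have := abs_add_le (rowCentred a p.1.1 p.1.2) (rowCentred a p.1.2 p.1.1)
  linarith

theorem symmCentred_le_of_mem {a : Fin n → Fin n → ℝ} (ha : ∀ i j, a i j = a j i)
    {d : Fin n → Fin n → ℝ} (hd : d ∈ ({symmCentred a, rowCentred a} : Set (Fin n → Fin n → ℝ))) :
    offDiagSq (symmCentred a) ≤ offDiagSq d ∧ offDiagMax (symmCentred a) ≤ offDiagMax d := by
  rcases hd with rfl | rfl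
  · exact ⟨le_rfl, le_rfl⟩
  · exact ⟨offDiagSq_symmCentred_le ha, offDiagMax_symmCentred_le ha⟩

end Centring

/-! ### Hoeffding's statistic under a conjugation invariant law -/

section ConjInvariant

variable {n : ℕ} {a : Fin n → Fin n → ℝ} {Ω : Type*} [MeasurableSpace Ω] (P : Measure Ω)
  [IsProbabilityMeasure P] {π : Ω → Perm (Fin n)}

/-- The mean, the variance and the tails of Hoeffding's statistic for a conjugation invariant law
on fixed point free permutations. -/
theorem hoeffdingStat_conj_invariant (hn : 5 ≤ n) (ha : ∀ i j, a i j = a j i)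
    (hπ : ∀ τ, MeasurableSet {ω | π ω = τ})
    (hconj : ∀ σ τ, P.real {ω | π ω = σ * τ * σ⁻¹} = P.real {ω | π ω = τ})
    (hfix : ∀ τ, P.real {ω | π ω = τ} ≠ 0 → ∀ x, τ x ≠ x) {m : ℕ}
    (hm : ∀ τ, P.real {ω | π ω = τ} ≠ 0 → HasSmallNeighbourhoods τ m) {C : ℝ} (hC : C = 2 * m) {k : ℝ} (hk : 0 ≤ k)
    (hV : ∀ τ, P.real {ω | π ω = τ} ≠ 0 → ∑ σ, relabelStat (centredArray a) τ σ ^ 2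
      = Fintype.card (Perm (Fin n)) * (k * offDiagSq (symmCentred a))) :
    (∫ ω, hoeffdingStat a (π ω) ∂P) = meanConst a ∧
    variance (fun ω => hoeffdingStat a (π ω)) P = k * offDiagSq (symmCentred a) ∧
    ∀ d ∈ ({symmCentred a, rowCentred a} : Set (Fin n → Fin n → ℝ)),
      0 < k * offDiagSq d →
      TailBounds P (fun ω => hoeffdingStat a (π ω) - meanConst a)
        (k * offDiagSq d) (C * offDiagMax d) := by
  subst hC
  set p : Perm (Fin n) → ℝ := fun τ => P.real {ω | π ω = τ} with hp
  set X : Perm (Fin n) → ℝ := fun τ => hoeffdingStat a τ - meanConst a with hXdef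
  have hd := isCentred_centredArray hn ha
  have hp0 : ∀ τ, 0 ≤ p τ := fun τ => measureReal_nonneg
  have hp1 : ∑ τ, p τ = 1 := by
    have := integral_comp_eq_sum P hπ fun _ => 1
    simpa using this.symm
  have hX : ∀ τ, p τ ≠ 0 → X τ = ∑ i, centredArray a i (τ i) := fun τ h =>
    hoeffdingStat_sub_meanConst hn a (hfix τ h)
  have hcard : 1 < Fintype.card (Fin n) := by rw [Fintype.card_fin]; omega
  have hmean : ∫ ω, hoeffdingStat a (π ω) ∂P = meanConst a := by
    have h0 := sum_mul_stat_eq_zero hd hconj hX hfix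
    rw [integral_comp_eq_sum P hπ (hoeffdingStat a)]
    have h1 : ∑ τ, p τ * X τ = ∑ τ, p τ * hoeffdingStat a τ - meanConst a := by
      simp only [hXdef, mul_sub, Finset.sum_sub_distrib, ← Finset.sum_mul, hp1, one_mul]
    linarith
  refine ⟨hmean, ?_, fun d hdmem hpos => ?_⟩
  · rw [variance_eq_integral (measurable_comp_of_finite hπ _).aemeasurable, hmean,
      integral_comp_eq_sum P hπ fun τ => (hoeffdingStat a τ - meanConst a) ^ 2]
    exact sum_mul_stat_sq hconj hp1 hX hV
  · obtain ⟨hsq, hmax⟩ := symmCentred_le_of_mem ha hdmem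
    obtain ⟨x⟩ : Nonempty (Fin n) := ⟨⟨0, by omega⟩⟩
    have hm0 : 0 < m := by
      obtain ⟨τ, hτ⟩ : ∃ τ, p τ ≠ 0 := by
        by_contra! h
        simp [h] at hp1
      obtain ⟨A, hA, -, -, -, -, -, h⟩ := hm τ hτ x x
      have := Finset.card_pos.2 ⟨x, hA⟩
      omega
    have hdmax : 0 < offDiagMax d := offDiagMax_pos fun h => by simp [h] at hpos
    have hc : 2 * offDiagMax (symmCentred a) * m ≤ 2 * m * offDiagMax d := by
      have : (m : ℝ) * offDiagMax (symmCentred a) ≤ m * offDiagMax d := by gcongr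
      linarith
    have hv : k * offDiagSq (symmCentred a) ≤ k * offDiagSq d := by gcongr
    have hV0 : 0 ≤ k * offDiagSq (symmCentred a) := mul_nonneg hk (offDiagSq_nonneg _)
    refine tailBounds_of_expBiasBound P hπ X hpos (by positivity) ?_ ?_
    · exact (expBiasBound_of_conj_invariant hd (abs_centredArray_le a) hcard hp0 hconj hX hfix hm
        hV).mono hp0 hV0 hv hc
    · refine (expBiasBound_of_conj_invariant (X := fun τ => -X τ) hd.neg
        (fun i j => (abs_neg _).trans_le (abs_centredArray_le a i j)) hcard hp0 hconj
        (fun τ h => ?_) hfix hm fun τ h => ?_).mono hp0 hV0 hv hc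
      · simp only [hX τ h, Finset.sum_neg_distrib]
      · simp only [relabelStat_neg, neg_sq, hV τ h]

end ConjInvariant

/-! ### Cycle types -/

section CycleType

variable {n : ℕ}

theorem cycleCount_conj (σ τ : Perm (Fin n)) (q : ℕ) :
    cycleCount q (σ * τ * σ⁻¹) = cycleCount q τ := by
  unfold cycleCount
  rw [Perm.partition_eq_of_isConj.1 (isConj_iff.2 ⟨σ, rfl⟩ : IsConj τ (σ * τ * σ⁻¹))]

theorem apply_ne_of_cycleCount_one {τ : Perm (Fin n)} (h : cycleCount 1 τ = 0) (x : Fin n) :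
    τ x ≠ x := by
  intro hx
  rw [cycleCount, Perm.parts_partition, Multiset.count_add, Multiset.count_replicate_self] at h
  have h1 : τ.support.card < Fintype.card (Fin n) :=
    Finset.card_lt_univ_of_notMem (Perm.notMem_support.2 hx)
  omega

theorem apply_apply_ne_of_cycleCount_two {τ : Perm (Fin n)} (h : cycleCount 2 τ = 0) {x : Fin n}
    (hx : τ x ≠ x) : τ (τ x) ≠ x := by
  intro h2
  rw [cycleCount, Perm.parts_partition, Multiset.count_add] at h
  refine Multiset.count_eq_zero.1 (Nat.eq_zero_of_add_eq_zero_right h) ?_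
  rw [Perm.mem_cycleType_iff]
  refine ⟨swap x (τ x), swap x (τ x) * τ, by simp [← mul_assoc], ?_,
    Perm.isCycle_swap hx.symm, Perm.card_support_swap hx.symm⟩
  intro y
  by_cases h3 : y = x
  · right; simp [h3]
  by_cases h4 : y = τ x
  · right; simp [h4, h2]
  · left; exact swap_apply_of_ne_of_ne h3 h4

theorem conj_mem_fpfInvolutions (σ τ : Perm (Fin n)) :
    σ * τ * σ⁻¹ ∈ fpfInvolutions n ↔ τ ∈ fpfInvolutions n := by
  simp only [fpfInvolutions, Finset.mem_filter, Finset.mem_univ, true_and, Perm.mul_apply, ne_eq]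
  constructor
  · rintro ⟨h1, h2⟩
    exact ⟨fun i => by simpa using h1 (σ i), fun i => by simpa using h2 (σ i)⟩
  · rintro ⟨h1, h2⟩
    refine ⟨fun i => by simp [h1], fun i h => h2 (σ⁻¹ i) ?_⟩
    rw [Perm.eq_inv_iff_eq]; exact h

end CycleType

end CombClt

theorem theorem3p2 (n : ℕ) (hn : 5 ≤ n) (a : Fin n → Fin n → ℝ) (ha : ∀ i j, a i j = a j i)
    {Ω : Type*} [MeasurableSpace Ω] (P : Measure Ω) [IsProbabilityMeasure P]
    (π : Ω → Equiv.Perm (Fin n)) (hπ : ∀ τ, MeasurableSet {ω | π ω = τ}) :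
    (CombClt.IsUniformFpfInvolution P π →
      (∫ ω, CombClt.hoeffdingStat a (π ω) ∂P) = CombClt.meanConst a ∧
      variance (fun ω => CombClt.hoeffdingStat a (π ω)) P
        = CombClt.varInvolution (CombClt.symmCentred a) ∧
      ∀ d ∈ ({CombClt.symmCentred a, CombClt.rowCentred a} : Set (Fin n → Fin n → ℝ)),
        0 < CombClt.varInvolution d →
        CombClt.TailBounds P (fun ω => CombClt.hoeffdingStat a (π ω) - CombClt.meanConst a)
          (CombClt.varInvolution d) (24 * CombClt.offDiagMax d)) ∧
    (CombClt.IsConstantOnCycleType P π →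
      (∀ᵐ ω ∂P, CombClt.cycleCount 1 (π ω) = 0 ∧ CombClt.cycleCount 2 (π ω) = 0) →
      (∫ ω, CombClt.hoeffdingStat a (π ω) ∂P) = CombClt.meanConst a ∧
      variance (fun ω => CombClt.hoeffdingStat a (π ω)) P
        = CombClt.varLongCycles (CombClt.symmCentred a) ∧
      ∀ d ∈ ({CombClt.symmCentred a, CombClt.rowCentred a} : Set (Fin n → Fin n → ℝ)),
        0 < CombClt.varLongCycles d →
        CombClt.TailBounds P (fun ω => CombClt.hoeffdingStat a (π ω) - CombClt.meanConst a)
          (CombClt.varLongCycles d) (40 * CombClt.offDiagMax d)) := by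
  open CombClt in
  have hn' : (5 : ℝ) ≤ n := by exact_mod_cast hn
  have hcard : 4 ≤ Fintype.card (Fin n) := by rw [Fintype.card_fin]; omega
  have hd := isCentred_centredArray hn ha
  constructor
  · intro hu
    have hmem : ∀ τ, P.real {ω | π ω = τ} ≠ 0 → (∀ i, τ (τ i) = i) ∧ ∀ i, τ i ≠ i := by
      intro τ h
      rw [hu τ] at h
      have : τ ∈ fpfInvolutions n := by
        by_contra h'
        simp [h'] at h
      simpa [fpfInvolutions] using this
    have key := hoeffdingStat_conj_invariant P hn ha hπ
      (fun σ τ => by rw [hu, hu, if_congr (conj_mem_fpfInvolutions σ τ) rfl rfl])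
      (fun τ h => (hmem τ h).2) (m := 12)
      (fun τ h => hasSmallNeighbourhoods_of_involution (hmem τ h).1) (C := 24) (by norm_num)
      (k := 2 * ((n : ℝ) - 2) / (((n : ℝ) - 1) * ((n : ℝ) - 3)))
      (div_nonneg (by linarith) (mul_nonneg (by linarith) (by linarith)))
      fun τ h => by
        rw [sum_relabelStat_sq_of_involution hd hcard (hmem τ h).2 (hmem τ h).1,
          sum_centredArray_sq, Fintype.card_fin]
    exact key
  · intro hc hae
    have hmem : ∀ τ, P.real {ω | π ω = τ} ≠ 0 → (∀ i, τ i ≠ i) ∧ ∀ i, τ (τ i) ≠ i := by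
      intro τ h
      have : cycleCount 1 τ = 0 ∧ cycleCount 2 τ = 0 := by
        by_contra h'
        refine h ?_
        rw [measureReal_eq_zero_iff]
        refine measure_mono_null (fun ω hω => ?_) (ae_iff.1 hae)
        rw [Set.mem_ofPred_eq] at hω ⊢
        rwa [hω]
      have h1 := apply_ne_of_cycleCount_one this.1
      exact ⟨h1, fun i => apply_apply_ne_of_cycleCount_two this.2 (h1 i)⟩
    have key := hoeffdingStat_conj_invariant P hn ha hπ
      (fun σ τ => hc _ _ fun q => cycleCount_conj σ τ q)
      (fun τ h => (hmem τ h).1) (m := 20) (fun τ _ => hasSmallNeighbourhoods τ)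
      (C := 40) (by norm_num)
      (k := 1 / ((n : ℝ) - 1)) (div_nonneg zero_le_one (by linarith))
      fun τ h => by
        rw [sum_relabelStat_sq_of_long_cycles hd hcard (hmem τ h).1 (hmem τ h).2,
          sum_centredArray_sq, Fintype.card_fin]
    exact key
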